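/- **Setting.** Let $d\ge 1$ and $\lambda>0$. A probability measure on $\mathbb R^d$ is *elliptic*, written $\mu\sim E(m,\Sigma,g)$, if $m\in\mathbb R^d$, $\Sigma\in\mathbb R^{d\times d}$ is symmetric positive definite, and $\mu$ has Lebesgue density $p_{m,\Sigma,g}(x)=\det(\Sigma)^{-1/2}g\big((x-m)^{T}\Sigma^{-1}(x-m)\big)$, where $g\colon[0,\infty)\to(0,\infty)$ is smooth and integrable with $\frac{\pi^{d/2}}{\Gamma(d/2)}\int_0^\infty r^{d/2-1}g(r)\,dr=1$, $\int_0^\infty r^{(d-1)/2}g(r)\,dr<\infty$ and $\int_0^\infty r^{d/2}g(r)\,dr<\infty$. Put $\kappa_g:=\frac1d\int_{\mathbb R^d}\|y\|^2g(\|y\|^2)\,dy$. For a smooth positive probability density $\rho$ on $\mathbb R^d$ with finite second moment let $C(\rho)$ be its covariance matrix. A *Kalman–Wasserstein dual geodesic with potential* $f\in C^\infty(\mathbb R^d)$ is a smooth curve $(\rho_t)_{t\in[0,1]}$ of such densities ($(t,x)\mapsto\rho_t(x)$ smooth, $t\mapsto C(\rho_t)$ continuous) with $$\partial_t\rho_t=-\nabla\cdot\big(\rho_t\,(C(\rho_t)+\lambda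 I)\nabla f\big).$$ The Kalman–Wasserstein divergence of two probability measures on $\mathbb R^d$ is $$D^{KW}(\mu\mid\nu):=\inf\int_0^1 t\int_{\mathbb R^d}\big\langle\nabla f,(C(\rho_t)+\lambda I)\nabla f\big\rangle\rho_t\,dx\,dt\in[0,\infty],$$ where the infimum is over all such geodesics with a quadratic potential $f(x)=\frac12x^{T}Bx+b^{T}x+c$ ($B$ symmetric) for which $\rho_0$ and $\rho_1$ are the densities of $\mu$ and $\nu$. **Theorem (KWKL divergence).** Let $\mu\sim E(m_0,\Sigma_0,g)$ and $\nu\sim E(m_1,\Sigma_1,g)$, where $\Sigma_0$ and $\Sigma_1$ are simultaneously diagonalizable. Set $\Delta m:=m_1-m_0$, $\Delta\Sigma:=\Sigma_1-\Sigma_0$, $P:=\Delta\Sigma(\Delta\Sigma)^{\dagger}$, $\Delta\Sigma^{\perp}:=I-P$ and $\Sigma_{\ell,\lambda}:=\kappa_g\Sigma_\ell+\lambda I$ for $\ell\in\{0,1\}$, where $\dagger$ is the Moore–Penrose inverse, and $$\Xi:=\Sigma_1\ln\big(\Sigma_1\Sigma_0^{-1}\big)+\frac1{\kappa_g}\Sigma_{1,\lambda}\ln\big(\Sigma_{0,\lambda}\Sigma_{1,\lambda}^{-1}\big).$$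 Then, for every $\lambda>0$, $D^{KW}(\mu\mid\nu)$ is finite and $$D^{KW}(\mu\mid\nu)=\frac{\kappa_g}{4\lambda}\operatorname{tr}(\Xi)+\frac12\,\Delta m^{T}\Big(\Delta\Sigma^{\perp}\Sigma_{0,\lambda}^{-1}\Delta\Sigma^{\perp}+\frac1{2\lambda}P\,\Xi\,P\,\big((\sqrt{\Sigma_1}-\sqrt{\Sigma_0})^{\dagger}\big)^{2}\Big)\Delta m .$$ -/

import Mathlib

open MeasureTheory Set
open scoped Matrix ENNReal ContDiff

noncomputable section

namespace KW

/-- `ℝᵈ` with its Euclidean structure and Lebesgue measure. -/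
abbrev E (d : ℕ) : Type := EuclideanSpace ℝ (Fin d)

/-- A matrix acting on a vector of `ℝᵈ`. -/
def act {d : ℕ} (A : Matrix (Fin d) (Fin d) ℝ) (x : E d) : E d :=
  WithLp.toLp 2 (A *ᵥ x.ofLp)

/-- The quadratic form `xᵀ A x`. -/
def quadForm {d : ℕ} (A : Matrix (Fin d) (Fin d) ℝ) (x : E d) : ℝ :=
  x.ofLp ⬝ᵥ (A *ᵥ x.ofLp)

/-! ### Elliptic distributions -/

/-- Admissible density generators `g : [0,∞) → (0,∞)` in dimension `d`: smooth, positive and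
integrable, normalized, with finite expectation and finite variance.
Only the values of `g` on `[0,∞)` matter. -/
structure IsGenerator (d : ℕ) (g : ℝ → ℝ) : Prop where
  smooth : ContDiffOn ℝ ∞ g (Ici 0)
  pos : ∀ r, 0 ≤ r → 0 < g r
  integrable : IntegrableOn g (Ioi 0)
  normalized : Real.pi ^ ((d : ℝ) / 2) / Real.Gamma ((d : ℝ) / 2) *
    ∫ r in Ioi (0 : ℝ), r ^ ((d : ℝ) / 2 - 1) * g r = 1
  finite_expectation : IntegrableOn (fun r : ℝ => r ^ (((d : ℝ) - 1) / 2) * g r) (Ioi 0)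
  finite_variance : IntegrableOn (fun r : ℝ => r ^ ((d : ℝ) / 2) * g r) (Ioi 0)

/-- The density `det(Σ)^(-1/2) g((x - m)ᵀ Σ⁻¹ (x - m))`. -/
def ellipticDensity {d : ℕ} (m : E d) (S : Matrix (Fin d) (Fin d) ℝ) (g : ℝ → ℝ) (x : E d) : ℝ :=
  S.det ^ (-(1 / 2) : ℝ) * g (quadForm S⁻¹ (x - m))

/-- The measure with Lebesgue density `ρ`. -/
def ofDensity {d : ℕ} (ρ : E d → ℝ) : Measure (E d) :=
  volume.withDensity fun x => ENNReal.ofReal (ρ x)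

/-- `μ ∼ E(m, Σ, g)`. -/
structure IsElliptic {d : ℕ} (m : E d) (S : Matrix (Fin d) (Fin d) ℝ) (g : ℝ → ℝ)
    (μ : Measure (E d)) : Prop where
  posDef : S.PosDef
  generator : IsGenerator d g
  density : μ = ofDensity (ellipticDensity m S g)

/-- `κ_g = (1/d) ∫ ‖y‖² g(‖y‖²) dy`. -/
def kappa (d : ℕ) (g : ℝ → ℝ) : ℝ :=
  1 / (d : ℝ) * ∫ y : E d, ‖y‖ ^ 2 * g (‖y‖ ^ 2)

/-! ### The Kalman–Wasserstein geometry -/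

/-- Smooth positive probability densities on `ℝᵈ` with finite second moment, so that the
covariance is defined. -/
structure IsSmoothPosDensity {d : ℕ} (ρ : E d → ℝ) : Prop where
  smooth : ContDiff ℝ ∞ ρ
  pos : ∀ x, 0 < ρ x
  integral_eq_one : ∫ x, ρ x = 1
  second_moment : Integrable fun x => ‖x‖ ^ 2 * ρ x

/-- The mean of a density, coordinatewise. -/
def mean {d : ℕ} (ρ : E d → ℝ) (i : Fin d) : ℝ := ∫ x : E d, x i * ρ x

/-- The covariance matrix `C(ρ)` of a density. -/
def cov {d : ℕ} (ρ : E d → ℝ) : Matrix (Fin d) (Fin d) ℝ :=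
  Matrix.of fun i j => ∫ x : E d, (x i - mean ρ i) * (x j - mean ρ j) * ρ x

/-- The divergence `∇ · v` of a vector field on `ℝᵈ`. -/
def divergence {d : ℕ} (v : E d → E d) (x : E d) : ℝ :=
  ∑ i, fderiv ℝ (fun y => v y i) x (EuclideanSpace.single i 1)

/-- The velocity field `(C(ρ) + λ I) ∇f`. -/
def velocity {d : ℕ} (lam : ℝ) (ρ f : E d → ℝ) (x : E d) : E d :=
  act (cov ρ + lam • (1 : Matrix (Fin d) (Fin d) ℝ)) (gradient f x)

/-- The Kalman–Wasserstein inertia operator `[f] ↦ -∇ · (ρ (C(ρ) + λ I) ∇f)`. -/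
def inertia {d : ℕ} (lam : ℝ) (ρ f : E d → ℝ) (x : E d) : ℝ :=
  -divergence (fun y => ρ y • velocity lam ρ f y) x

/-- The squared norm `∫ ⟨∇f, ρ (C(ρ) + λ I) ∇f⟩ dx` of the covector `[f]`, which is also that of
the tangent vector `inertia lam ρ f`. For `0 ≤ λ` the integrand is nonnegative. -/
def metricSq {d : ℕ} (lam : ℝ) (ρ f : E d → ℝ) : ℝ≥0∞ :=
  ∫⁻ x, ENNReal.ofReal (inner ℝ (gradient f x) (ρ x • velocity lam ρ f x))

/-- `ρ : [0,1] → P₊^∞(ℝᵈ)` is a smooth curve and it is the dual geodesic of the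
Kalman–Wasserstein geometry with potential `f`, that is, `∂ₜ ρ_t = φ_{ρ_t}([f])`. -/
structure IsDualGeodesic {d : ℕ} (lam : ℝ) (f : E d → ℝ) (ρ : ℝ → E d → ℝ) : Prop where
  potential_smooth : ContDiff ℝ ∞ f
  density : ∀ t ∈ Icc (0 : ℝ) 1, IsSmoothPosDensity (ρ t)
  smooth : ContDiffOn ℝ ∞ (fun p : ℝ × E d => ρ p.1 p.2) (Icc (0 : ℝ) 1 ×ˢ univ)
  cov_continuous : ContinuousOn (fun t => cov (ρ t)) (Icc (0 : ℝ) 1)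
  geodesic : ∀ t ∈ Icc (0 : ℝ) 1, ∀ x : E d,
    HasDerivWithinAt (fun s => ρ s x) (inertia lam (ρ t) f x) (Icc (0 : ℝ) 1) t

/-- Quadratic potentials `f(x) = ½ xᵀ B x + bᵀ x + c` with `B` symmetric. -/
def IsQuadratic {d : ℕ} (f : E d → ℝ) : Prop :=
  ∃ (B : Matrix (Fin d) (Fin d) ℝ) (b : E d) (c : ℝ), B.IsSymm ∧
    ∀ x, f x = 1 / 2 * quadForm B x + inner ℝ b x + c

/-- `∫₀¹ t g_{γ(t)}(γ'(t), γ'(t)) dt` along the dual geodesic with potential `f`. -/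
def action {d : ℕ} (lam : ℝ) (f : E d → ℝ) (ρ : ℝ → E d → ℝ) : ℝ≥0∞ :=
  ∫⁻ t in Icc (0 : ℝ) 1, ENNReal.ofReal t * metricSq lam (ρ t) f

/-- The Kalman–Wasserstein divergence `D^KW(μ | ν)` on the noncompact space `ℝᵈ`: the infimum of
the action over the Kalman–Wasserstein dual geodesics from `μ` to `ν` that have a quadratic
potential (`∞` if there is none). -/
def divKW {d : ℕ} (lam : ℝ) (μ ν : Measure (E d)) : ℝ≥0∞ :=
  ⨅ (f : E d → ℝ) (ρ : ℝ → E d → ℝ) (_ : IsQuadratic f) (_ : IsDualGeodesic lam f ρ)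
    (_ : ofDensity (ρ 0) = μ) (_ : ofDensity (ρ 1) = ν), action lam f ρ

/-! ### Matrix functions -/

/-- `A` and `B` are diagonal in a common basis. -/
def SimDiag {d : ℕ} (A B : Matrix (Fin d) (Fin d) ℝ) : Prop :=
  ∃ (Q : Matrix (Fin d) (Fin d) ℝ) (a b : Fin d → ℝ), IsUnit Q.det ∧
    A = Q * Matrix.diagonal a * Q⁻¹ ∧ B = Q * Matrix.diagonal b * Q⁻¹

/-- The logarithm of a symmetric positive definite matrix. -/
def mlog {d : ℕ} (A : Matrix (Fin d) (Fin d) ℝ) : Matrix (Fin d) (Fin d) ℝ :=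
  cfc Real.log A

/-- The square root of a symmetric positive semidefinite matrix. -/
def msqrt {d : ℕ} (A : Matrix (Fin d) (Fin d) ℝ) : Matrix (Fin d) (Fin d) ℝ :=
  cfc Real.sqrt A

/-- The Moore–Penrose inverse `A†` of a symmetric matrix: nonzero eigenvalues are inverted, and
the eigenvalue `0` is kept, since `0⁻¹ = 0`. -/
def pinv {d : ℕ} (A : Matrix (Fin d) (Fin d) ℝ) : Matrix (Fin d) (Fin d) ℝ :=
  cfc (fun x : ℝ => x⁻¹) A

/-- `Σ_λ = κ Σ + λ I`. -/
def inflate {d : ℕ} (κ lam : ℝ) (S : Matrix (Fin d) (Fin d) ℝ) : Matrix (Fin d) (Fin d) ℝ :=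
  κ • S + lam • (1 : Matrix (Fin d) (Fin d) ℝ)

/-- `Ξ = Σ₁ ln(Σ₁ Σ₀⁻¹) + κ⁻¹ Σ_{1,λ} ln(Σ_{0,λ} Σ_{1,λ}⁻¹)`. -/
def Xi {d : ℕ} (κ lam : ℝ) (S₀ S₁ : Matrix (Fin d) (Fin d) ℝ) : Matrix (Fin d) (Fin d) ℝ :=
  S₁ * mlog (S₁ * S₀⁻¹) +
    (1 / κ) • (inflate κ lam S₁ * mlog (inflate κ lam S₀ * (inflate κ lam S₁)⁻¹))

/-- `P = ΔΣ (ΔΣ)†`, the orthogonal projection onto the range of `ΔΣ = Σ₁ - Σ₀`. -/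
def proj {d : ℕ} (S₀ S₁ : Matrix (Fin d) (Fin d) ℝ) : Matrix (Fin d) (Fin d) ℝ :=
  (S₁ - S₀) * pinv (S₁ - S₀)

/-- `ΔΣ^⊥ = I - ΔΣ (ΔΣ)†`. -/
def projPerp {d : ℕ} (S₀ S₁ : Matrix (Fin d) (Fin d) ℝ) : Matrix (Fin d) (Fin d) ℝ :=
  1 - proj S₀ S₁

end KW

end

/-!
For a quadratic potential `½ xᵀ B x + bᵀ x + c` the velocity `(C(ρ) + λ I) ∇f` is affine in `x`,
so a dual geodesic is the push-forward of `ρ₀` by affine maps. Its covariance therefore solves the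
Riccati equation `C' = (C + λ) B C + C B (C + λ)`. For `Z = I + λ C⁻¹` this reads
`Z' = -λ (B Z + Z B)`, so that `exp (t λ B) Z exp (t λ B)` is constant. When `C(ρ₀)` and `C(ρ₁)` are
diagonal in a common orthonormal basis, evaluating at `t = 0, 1` shows that `B` and all `C(ρ_t)`
are diagonal in that basis.

The problem thus splits into scalar equations `c' = 2 β c (c + λ)`, `n' = (c + λ) (β n + b)` for the
variance and the mean of each coordinate. The first integrals `log (c / (c + λ)) - 2 λ β t` and
`(β n + b) / √c` determine the action from the endpoint data: every geodesic between `μ` and `ν` has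
the same action, and solving the scalar equations explicitly gives one.
-/

noncomputable section

namespace KW

/-! ### Symmetric matrices with a prescribed orthonormal eigenbasis -/

section Odiag

variable {n : Type*} [Fintype n] [DecidableEq n]

/-- The symmetric matrix with eigenvalues `a` in the orthonormal basis given by the columns of `U`.
As a function of `a` it is a homomorphism of algebras, so that computations with matrices that are
diagonal in the same basis take place in `n → ℝ`. -/
def odiag (U : Matrix.unitaryGroup n ℝ) : (n → ℝ) →ₐ[ℝ] Matrix n n ℝ :=
  (Unitary.conjStarAlgAut ℝ (Matrix n n ℝ) U).toAlgEquiv.toAlgHom.comp (Matrix.diagonalAlgHom ℝ)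

theorem coe_mul_transpose (U : Matrix.unitaryGroup n ℝ) : U.1 * U.1ᵀ = 1 := by
  simpa only [Matrix.star_eq_conjTranspose, Matrix.conjTranspose_eq_transpose_of_trivial]
    using Unitary.mul_star_self_of_mem U.2

theorem transpose_mul_coe (U : Matrix.unitaryGroup n ℝ) : U.1ᵀ * U.1 = 1 :=
  mul_eq_one_comm.mp (coe_mul_transpose U)

variable (U : Matrix.unitaryGroup n ℝ) (a b : n → ℝ)

theorem odiag_apply : odiag U a = U.1 * Matrix.diagonal a * U.1ᵀ := by
  simp [odiag, Matrix.star_eq_conjTranspose]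

theorem odiag_transpose : (odiag U a)ᵀ = odiag U a := by
  simp only [odiag_apply, Matrix.transpose_mul, Matrix.transpose_transpose,
    Matrix.diagonal_transpose, mul_assoc]

theorem odiag_isHermitian : (odiag U a).IsHermitian := by
  rw [Matrix.IsHermitian, Matrix.conjTranspose_eq_transpose_of_trivial, odiag_transpose]

theorem odiag_injective : Function.Injective (odiag U) :=
  (Unitary.conjStarAlgAut ℝ (Matrix n n ℝ) U).injective.comp Matrix.diagonal_injective

theorem odiag_trace : (odiag U a).trace = ∑ i, a i := by
  rw [odiag_apply, Matrix.trace_mul_comm, ← mul_assoc, transpose_mul_coe, one_mul,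
    Matrix.trace_diagonal]

theorem odiag_inv {a : n → ℝ} (ha : ∀ i, a i ≠ 0) : (odiag U a)⁻¹ = odiag U a⁻¹ := by
  refine Matrix.inv_eq_right_inv ?_
  rw [← map_mul, ← map_one (odiag U)]
  exact congrArg _ (funext fun i => mul_inv_cancel₀ (ha i))

theorem odiag_posDef_iff {a : n → ℝ} : (odiag U a).PosDef ↔ ∀ i, 0 < a i := by
  rw [odiag_apply, ← Matrix.conjTranspose_eq_transpose_of_trivial, ← Matrix.star_eq_conjTranspose,
    Matrix.IsUnit.posDef_star_right_conjugate_iff (.of_mul_eq_one _ (coe_mul_transpose U)),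
    Matrix.posDef_diagonal_iff]

theorem exists_polynomial_eval_eq {ι K : Type*} [Finite ι] [Field K] {t v : ι → K}
    (h : v.FactorsThrough t) : ∃ p : Polynomial K, ∀ i, p.eval (t i) = v i := by
  classical
  have := Fintype.ofFinite ι
  refine ⟨Lagrange.interpolate (Finset.univ.image t) id (Function.extend t v 0), fun i => ?_⟩
  rw [← h.extend_apply 0 i]
  exact Lagrange.eval_interpolate_at_node _ Function.injective_id.injOn
    (Finset.mem_image_of_mem t (Finset.mem_univ i))

theorem spectrum_odiag_subset : spectrum ℝ (odiag U a) ⊆ range a := by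
  refine (AlgHom.spectrum_apply_subset (odiag U) a).trans ?_
  rw [Pi.spectrum_eq, iUnion_subset_iff]
  intro i x hx
  rw [← Algebra.algebraMap_self_apply (a i), spectrum.scalar_eq, mem_singleton_iff] at hx
  exact ⟨i, hx.symm⟩

theorem cfc_odiag (f : ℝ → ℝ) : cfc f (odiag U a) = odiag U (f ∘ a) := by
  obtain ⟨p, hp⟩ := exists_polynomial_eval_eq (t := a) (v := f ∘ a) fun i j h => congrArg f h
  have hfp : (spectrum ℝ (odiag U a)).EqOn f p.eval := fun x hx => by
    obtain ⟨i, rfl⟩ := spectrum_odiag_subset U a hx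
    exact (hp i).symm
  rw [cfc_congr hfp, cfc_polynomial p _ (show IsSelfAdjoint (odiag U a) from odiag_isHermitian U a),
    Polynomial.aeval_algHom_apply]
  congr 1
  ext i
  rw [Polynomial.aeval_fn_apply, Polynomial.coe_aeval_eq_eval, hp]

theorem exp_odiag : NormedSpace.exp (odiag U a) = odiag U (Real.exp ∘ a) := by
  have hU : U.1⁻¹ = U.1ᵀ := Matrix.inv_eq_right_inv (coe_mul_transpose U)
  have ha : NormedSpace.exp a = Real.exp ∘ a := by
    ext i
    rw [Pi.coe_exp, Function.comp_apply, Real.exp_eq_exp_ℝ]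
  rw [odiag_apply, odiag_apply, ← hU, ← ha,
    Matrix.exp_conj _ _ (.of_mul_eq_one _ (coe_mul_transpose U)), Matrix.exp_diagonal]

theorem exists_eq_odiag {T : Matrix n n ℝ} (hT : T.IsHermitian) :
    ∃ (U : Matrix.unitaryGroup n ℝ) (a : n → ℝ), T = odiag U a :=
  ⟨hT.eigenvectorUnitary, hT.eigenvalues, hT.spectral_theorem⟩

omit [DecidableEq n] in
theorem posDef_mul_self {R : Matrix n n ℝ} (hR : R.PosDef) : (R * R).PosDef := by
  classical
  have hsq := Matrix.PosDef.conjTranspose_mul_self R (Matrix.mulVec_injective_of_isUnit hR.isUnit)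
  rwa [hR.isHermitian.eq] at hsq

omit [DecidableEq n] in
theorem exists_posDef_mul_self_eq {S : Matrix n n ℝ} (hS : S.PosDef) :
    ∃ R : Matrix n n ℝ, R.PosDef ∧ R * R = S := by
  classical
  obtain ⟨U, a, rfl⟩ := exists_eq_odiag hS.isHermitian
  have ha := (odiag_posDef_iff U).mp hS
  refine ⟨odiag U fun i => √(a i), (odiag_posDef_iff U).mpr fun i => Real.sqrt_pos.mpr (ha i), ?_⟩
  rw [← map_mul]
  exact congrArg _ (funext fun i => Real.mul_self_sqrt (ha i).le)

theorem exists_add_mul_separating {ι K : Type*} [Finite ι] [Field K] [Infinite K] (a b : ι → K) :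
    ∃ s : K, ∀ i j, a i + s * b i = a j + s * b j → a i = a j ∧ b i = b j := by
  obtain ⟨s, hs⟩ := (Set.finite_range
    fun q : ι × ι => -(a q.1 - a q.2) / (b q.1 - b q.2)).exists_notMem
  refine ⟨s, fun i j hij => ?_⟩
  obtain hb | hb := eq_or_ne (b i) (b j)
  · exact ⟨by simpa [hb] using hij, hb⟩
  · refine absurd ⟨(i, j), ?_⟩ hs
    rw [div_eq_iff (sub_ne_zero.mpr hb)]
    linear_combination -hij

theorem exists_eq_odiag_of_conj_diagonal {Q : Matrix n n ℝ} (hQ : IsUnit Q.det) {a b : n → ℝ}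
    (ha : (Q * Matrix.diagonal a * Q⁻¹).IsHermitian)
    (hb : (Q * Matrix.diagonal b * Q⁻¹).IsHermitian) :
    ∃ (U : Matrix.unitaryGroup n ℝ) (a' b' : n → ℝ),
      Q * Matrix.diagonal a * Q⁻¹ = odiag U a' ∧ Q * Matrix.diagonal b * Q⁻¹ = odiag U b' := by
  let conj : (n → ℝ) →ₐ[ℝ] Matrix n n ℝ :=
    (MulSemiringAction.toAlgHom ℝ (Matrix n n ℝ)
      (ConjAct.toConjAct (Matrix.nonsingInvUnit Q hQ))).comp (Matrix.diagonalAlgHom ℝ)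
  have hconj : ∀ v, conj v = Q * Matrix.diagonal v * Q⁻¹ := fun v => by
    simp [conj, ConjAct.units_smul_def, Matrix.nonsingInvUnit]
  simp only [← hconj] at ha hb ⊢
  -- A generic combination separates the joint eigenvalues, so both matrices are polynomials in it.
  obtain ⟨s, hs⟩ := exists_add_mul_separating a b
  have hherm : (conj (a + s • b)).IsHermitian := by
    rw [map_add, map_smul]
    exact ha.add (hb.smul (IsSelfAdjoint.all s))
  obtain ⟨U, t, ht⟩ := exists_eq_odiag hherm
  have hpoly : ∀ v : n → ℝ, v.FactorsThrough (a + s • b) → ∃ v', conj v = odiag U v' :=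
      fun v hv => by
    obtain ⟨p, hp⟩ := exists_polynomial_eval_eq hv
    have hv' : v = Polynomial.aeval (a + s • b) p := funext fun i => by
      rw [Polynomial.aeval_fn_apply, Polynomial.coe_aeval_eq_eval, hp]
    exact ⟨Polynomial.aeval t p, by
      rw [hv', ← Polynomial.aeval_algHom_apply, ht, Polynomial.aeval_algHom_apply]⟩
  obtain ⟨a', ha'⟩ := hpoly a fun i j h => (hs i j h).1
  obtain ⟨b', hb'⟩ := hpoly b fun i j h => (hs i j h).2
  exact ⟨U, a', b', ha', hb'⟩

theorem SimDiag.exists_odiag {d : ℕ} {S₀ S₁ : Matrix (Fin d) (Fin d) ℝ} (h : SimDiag S₀ S₁)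
    (h₀ : S₀.IsHermitian) (h₁ : S₁.IsHermitian) :
    ∃ (U : Matrix.unitaryGroup (Fin d) ℝ) (a b : Fin d → ℝ), S₀ = odiag U a ∧ S₁ = odiag U b := by
  obtain ⟨Q, a, b, hQ, rfl, rfl⟩ := h
  exact exists_eq_odiag_of_conj_diagonal hQ h₀ h₁

end Odiag

/-! ### Linear differential equations with continuous coefficients -/

section LinearODE

theorem eq_left_of_hasDerivWithinAt_zero {V : Type*} [NormedAddCommGroup V] [NormedSpace ℝ V]
    {a b : ℝ} {f : ℝ → V} (hf : ∀ t ∈ Icc a b, HasDerivWithinAt f 0 (Icc a b) t) {t : ℝ}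
    (ht : t ∈ Icc a b) : f t = f a :=
  constant_of_has_deriv_right_zero (fun s hs => (hf s hs).continuousWithinAt)
    (fun s hs => (hf s (Ico_subset_Icc_self hs)).mono_of_mem_nhdsWithin
      (Icc_mem_nhdsGE_of_mem hs)) t ht

variable {V : Type*} [NormedAddCommGroup V] [NormedSpace ℝ V]

/-- The terms of the Picard series of `x' = L x`, `x 0 = x₀`. -/
def picardTerm (L : ℝ → V →L[ℝ] V) (x₀ : V) : ℕ → ℝ → V
  | 0 => fun _ => x₀
  | n + 1 => fun t => ∫ s in (0 : ℝ)..t, L s (picardTerm L x₀ n s)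

variable {L : ℝ → V →L[ℝ] V} {K : ℝ}

theorem continuous_picardTerm (hL : Continuous L) (x₀ : V) (n : ℕ) :
    Continuous (picardTerm L x₀ n) := by
  induction n with
  | zero => exact continuous_const
  | succ n ih =>
    exact intervalIntegral.continuous_primitive
      (fun a b => (hL.clm_apply ih).intervalIntegrable a b) 0

theorem norm_picardTerm_le (hL : Continuous L) (hK : ∀ t, ‖L t‖ ≤ K) (x₀ : V) (n : ℕ) (t : ℝ) :
    ‖picardTerm L x₀ n t‖ ≤ ‖x₀‖ * ((K * |t|) ^ n / n.factorial) := by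
  have hK0 : 0 ≤ K := (norm_nonneg _).trans (hK 0)
  induction n generalizing t with
  | zero => simp [picardTerm]
  | succ n ih =>
    have hc : Continuous fun s => L s (picardTerm L x₀ n s) :=
      hL.clm_apply (continuous_picardTerm hL x₀ n)
    calc ‖picardTerm L x₀ (n + 1) t‖ ≤ ∫ s in uIoc (0 : ℝ) t, ‖L s (picardTerm L x₀ n s)‖ :=
          intervalIntegral.norm_integral_le_integral_norm_uIoc
      _ ≤ ∫ s in uIoc (0 : ℝ) t, (‖x₀‖ * K ^ (n + 1) / n.factorial) * |s - 0| ^ n := by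
          refine integral_mono hc.norm.integrableOn_uIoc
            (Continuous.integrableOn_uIoc (by fun_prop)) fun s => ?_
          calc ‖L s (picardTerm L x₀ n s)‖ ≤ K * (‖x₀‖ * ((K * |s|) ^ n / n.factorial)) :=
                ((L s).le_opNorm _).trans (mul_le_mul (hK s) (ih s) (norm_nonneg _) hK0)
            _ = _ := by rw [sub_zero, mul_pow, pow_succ]; ring
      _ = _ := by
          rw [integral_const_mul, integral_pow_abs_sub_uIoc, Nat.factorial_succ, sub_zero, mul_pow]
          push_cast
          field_simp

variable [CompleteSpace V]

theorem summable_picardTerm (hL : Continuous L) (hK : ∀ t, ‖L t‖ ≤ K) (x₀ : V) (t : ℝ) :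
    Summable fun n => picardTerm L x₀ n t :=
  .of_norm_bounded ((Real.summable_pow_div_factorial (K * |t|)).mul_left ‖x₀‖)
    fun n => norm_picardTerm_le hL hK x₀ n t

theorem hasDerivAt_picardTerm_succ (hL : Continuous L) (x₀ : V) (n : ℕ) (t : ℝ) :
    HasDerivAt (picardTerm L x₀ (n + 1)) (L t (picardTerm L x₀ n t)) t := by
  have hc : Continuous fun s => L s (picardTerm L x₀ n s) :=
    hL.clm_apply (continuous_picardTerm hL x₀ n)
  exact intervalIntegral.integral_hasDerivAt_right (hc.intervalIntegrable 0 t)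
    hc.stronglyMeasurable.stronglyMeasurableAtFilter hc.continuousAt

theorem hasDerivAt_tsum_picardTerm_succ (hL : Continuous L) (hK : ∀ t, ‖L t‖ ≤ K) (x₀ : V)
    (t : ℝ) : HasDerivAt (fun s => ∑' n, picardTerm L x₀ (n + 1) s)
      (L t (∑' n, picardTerm L x₀ n t)) t := by
  have hK0 : 0 ≤ K := (norm_nonneg _).trans (hK 0)
  have ht : t ∈ Metric.ball 0 (|t| + 1) := by simp
  rw [(L t).map_tsum (summable_picardTerm hL hK x₀ t)]
  refine hasDerivAt_tsum_of_isPreconnected (g := fun n s => picardTerm L x₀ (n + 1) s)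
    (g' := fun n s => L s (picardTerm L x₀ n s))
    (((Real.summable_pow_div_factorial (K * (|t| + 1))).mul_left ‖x₀‖).mul_left K)
    Metric.isOpen_ball (convex_ball 0 (|t| + 1)).isPreconnected
    (fun n s _ => hasDerivAt_picardTerm_succ hL x₀ n s) (fun n s hs => ?_) ht
    ((summable_nat_add_iff 1).mpr (summable_picardTerm hL hK x₀ t)) ht
  have hs' : |s| ≤ |t| + 1 := (mem_ball_zero_iff.mp hs).le
  refine ((L s).le_opNorm _).trans
    (mul_le_mul (hK s) ((norm_picardTerm_le hL hK x₀ n s).trans ?_) (norm_nonneg _) hK0)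
  gcongr

theorem exists_hasDerivAt_linear (hL : Continuous L) (hK : ∀ t, ‖L t‖ ≤ K) (x₀ : V) :
    ∃ x : ℝ → V, x 0 = x₀ ∧ ∀ t, HasDerivAt x (L t (x t)) t := by
  have hsplit : ∀ t, ∑' n, picardTerm L x₀ n t = x₀ + ∑' n, picardTerm L x₀ (n + 1) t :=
    fun t => (summable_picardTerm hL hK x₀ t).tsum_eq_zero_add
  refine ⟨fun t => ∑' n, picardTerm L x₀ n t, ?_, fun t => ?_⟩
  · simp only [hsplit, picardTerm, intervalIntegral.integral_same, tsum_zero, add_zero]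
  · exact ((hasDerivAt_tsum_picardTerm_succ hL hK x₀ t).const_add x₀).congr_of_eventuallyEq
      (.of_forall hsplit)

theorem exists_hasDerivWithinAt_linear {L : ℝ → V →L[ℝ] V} {T : ℝ} (hT : 0 ≤ T)
    (hL : ContinuousOn L (Icc 0 T)) (x₀ : V) :
    ∃ x : ℝ → V, x 0 = x₀ ∧ ∀ t ∈ Icc 0 T, HasDerivWithinAt x (L t (x t)) (Icc 0 T) t := by
  obtain ⟨K, hK⟩ := isCompact_Icc.exists_bound_of_continuousOn hL
  obtain ⟨x, hx0, hx⟩ := exists_hasDerivAt_linear (L := IccExtend hT ((Icc 0 T).domRestrict L))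
    (continuousOn_iff_continuous_domRestrict.mp hL).Icc_extend' (fun t => hK _ (Subtype.prop _)) x₀
  refine ⟨x, hx0, fun t ht => ?_⟩
  simpa only [IccExtend_of_mem hT _ ht, domRestrict_apply] using (hx t).hasDerivWithinAt

end LinearODE

/-! ### Moments of densities and affine changes of variables -/

section Act

variable {d : ℕ} (A B : Matrix (Fin d) (Fin d) ℝ) (x y : E d)

/-- `act` as a continuous linear map, also in the matrix. -/
def actL : Matrix (Fin d) (Fin d) ℝ →L[ℝ] E d →L[ℝ] E d :=
  LinearMap.toContinuousLinearMap
    (Matrix.toEuclideanCLM (n := Fin d) (𝕜 := ℝ)).toAlgEquiv.toLinearEquiv.toLinearMap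

theorem actL_apply : actL A x = act A x := rfl

theorem act_apply (i : Fin d) : act A x i = ∑ j, A i j * x j := rfl

theorem act_add : act A (x + y) = act A x + act A y :=
  map_add (actL A) x y

theorem act_sub : act A (x - y) = act A x - act A y :=
  map_sub (actL A) x y

theorem add_act : act (A + B) x = act A x + act B x :=
  DFunLike.congr_fun (map_add actL A B) x

theorem act_neg : act A (-x) = -act A x :=
  map_neg (actL A) x

theorem neg_act : act (-A) x = -act A x :=
  DFunLike.congr_fun (map_neg actL A) x

theorem act_mul : act (A * B) x = act A (act B x) := by
  simp [act]

theorem act_one : act 1 x = x := by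
  simp [act]

theorem inner_act_right : inner ℝ x (act A y) = inner ℝ (act Aᵀ x) y := by
  have h := Matrix.inner_toEuclideanCLM Aᵀ y x
  rw [real_inner_comm] at h
  refine (Matrix.inner_toEuclideanCLM A x y).trans (Eq.trans ?_ h.symm)
  rw [Matrix.dotProduct_mulVec, ← Matrix.mulVec_transpose, dotProduct_comm]

theorem quadForm_eq_inner : quadForm A x = inner ℝ x (act A x) :=
  (Matrix.inner_toEuclideanCLM A x x).symm

theorem quadForm_one : quadForm 1 x = ‖x‖ ^ 2 := by
  rw [quadForm_eq_inner, act_one, real_inner_self_eq_norm_sq]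

theorem quadForm_eq_sum : quadForm A x = ∑ i, ∑ j, A i j * (x i * x j) := by
  simp only [quadForm, dotProduct, Matrix.mulVec, Finset.mul_sum]
  exact Finset.sum_congr rfl fun i _ => Finset.sum_congr rfl fun j _ => by ring

theorem quadForm_act_add (K : Matrix (Fin d) (Fin d) ℝ) :
    quadForm K (act A x + y) =
      quadForm (Aᵀ * K * A) x + inner ℝ (act (Aᵀ * (K + Kᵀ)) y) x + quadForm K y := by
  have hxx : inner ℝ (act A x) (act K (act A x)) = inner ℝ x (act Aᵀ (act K (act A x))) := by
    rw [inner_act_right Aᵀ, Matrix.transpose_transpose]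
  have hxy : inner ℝ (act A x) (act K y) = inner ℝ (act Aᵀ (act K y)) x := by
    rw [real_inner_comm, inner_act_right]
  have hyx : inner ℝ y (act K (act A x)) = inner ℝ (act Aᵀ (act Kᵀ y)) x := by
    rw [inner_act_right, inner_act_right]
  simp only [quadForm_eq_inner, act_mul, add_act, act_add, inner_add_left, inner_add_right,
    hxx, hxy, hyx]
  ring

theorem quadForm_act_add_recenter (K : Matrix (Fin d) (Fin d) ℝ) (m : E d) :
    quadForm K (act A x + y) = quadForm (Aᵀ * K * A) (x - m) +
      inner ℝ (act (Aᵀ * (K + Kᵀ)) (act A m + y)) (x - m) + quadForm K (act A m + y) := by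
  rw [← quadForm_act_add, act_sub]
  congr 1
  abel

theorem quadForm_odiag (U : Matrix.unitaryGroup (Fin d) ℝ) (a : Fin d → ℝ) :
    quadForm (odiag U a) x = ∑ i, a i * act U.1ᵀ x i ^ 2 := by
  rw [quadForm_eq_inner, odiag_apply, act_mul, act_mul, inner_act_right, ← quadForm_eq_inner,
    quadForm_eq_sum]
  refine Finset.sum_congr rfl fun i _ => ?_
  simp only [Matrix.diagonal_apply, ite_mul, zero_mul, Finset.sum_ite_eq, Finset.mem_univ, if_true,
    sq]

theorem abs_quadForm_le : |quadForm A x| ≤ ‖actL A‖ * ‖x‖ ^ 2 := by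
  rw [quadForm_eq_inner]
  calc |inner ℝ x (act A x)| ≤ ‖x‖ * ‖act A x‖ := abs_real_inner_le_norm _ _
    _ ≤ ‖x‖ * (‖actL A‖ * ‖x‖) := by gcongr; exact (actL A).le_opNorm x
    _ = _ := by ring

theorem continuous_quadForm : Continuous (quadForm A) := by
  simp only [funext (quadForm_eq_inner A)]
  exact continuous_id.inner (actL A).continuous

theorem det_actL : (actL A).det = A.det := by
  change (Matrix.toEuclideanCLM (n := Fin d) (𝕜 := ℝ) A).det = A.det
  rw [ContinuousLinearMap.det, Matrix.coe_toEuclideanCLM_eq_toEuclideanLin]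
  simp

variable {A}

theorem bijective_act_add (hA : A.det ≠ 0) (a : E d) : Function.Bijective fun y => act A y + a := by
  have hu : IsUnit A.det := isUnit_iff_ne_zero.mpr hA
  refine Function.bijective_iff_has_inverse.mpr ⟨fun x => act A⁻¹ (x - a), fun y => ?_, fun x => ?_⟩
  · simp only [add_sub_cancel_right, ← act_mul, Matrix.nonsing_inv_mul _ hu, act_one]
  · simp only [← act_mul, Matrix.mul_nonsing_inv _ hu, act_one, sub_add_cancel]

theorem hasFDerivAt_act_add (A : Matrix (Fin d) (Fin d) ℝ) (a x : E d) :
    HasFDerivAt (fun y => act A y + a) (actL A) x :=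
  (actL A).hasFDerivAt.add_const a

variable {F : Type*} [NormedAddCommGroup F] [NormedSpace ℝ F]

theorem integral_comp_act_add (hA : A.det ≠ 0) (a : E d) (φ : E d → F) :
    ∫ y, |A.det| • φ (act A y + a) = ∫ x, φ x := by
  have hb := bijective_act_add hA a
  have := integral_image_eq_integral_abs_det_fderiv_smul volume MeasurableSet.univ
    (fun x _ => (hasFDerivAt_act_add A a x).hasFDerivWithinAt) hb.injective.injOn φ
  simpa [image_univ, hb.surjective.range_eq, det_actL] using this.symm

theorem integrable_comp_act_add_iff (hA : A.det ≠ 0) (a : E d) (φ : E d → F) :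
    (Integrable fun y => |A.det| • φ (act A y + a)) ↔ Integrable φ := by
  have hb := bijective_act_add hA a
  have := integrableOn_image_iff_integrableOn_abs_det_fderiv_smul volume MeasurableSet.univ
    (fun x _ => (hasFDerivAt_act_add A a x).hasFDerivWithinAt) hb.injective.injOn φ
  simpa [image_univ, hb.surjective.range_eq, det_actL] using this.symm

end Act

section Moments

variable {d : ℕ}

theorem integrable_mul_of_abs_le {V : Type*} [NormedAddCommGroup V] [MeasurableSpace V]
    [OpensMeasurableSpace V] [SecondCountableTopology V] {μ : Measure V} {ρ w : V → ℝ}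
    (h₀ : Integrable ρ μ) (h₂ : Integrable (fun x => ‖x‖ ^ 2 * ρ x) μ) (hw : Continuous w) {K : ℝ}
    (hK : ∀ x, |w x| ≤ K * (1 + ‖x‖ ^ 2)) : Integrable (fun x => w x * ρ x) μ := by
  refine ((h₀.norm.add h₂.norm).const_mul K).mono'
    (hw.aestronglyMeasurable.mul h₀.aestronglyMeasurable) (.of_forall fun x => ?_)
  calc ‖w x * ρ x‖ = |w x| * ‖ρ x‖ := norm_mul _ _
    _ ≤ K * (1 + ‖x‖ ^ 2) * ‖ρ x‖ := by gcongr; exact hK x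
    _ = K * (‖ρ x‖ + ‖‖x‖ ^ 2 * ρ x‖) := by rw [norm_mul, norm_pow, norm_norm]; ring

theorem norm_sub_sq_le {V : Type*} [SeminormedAddCommGroup V] (x y : V) :
    ‖x - y‖ ^ 2 ≤ (1 + ‖y‖ ^ 2) * (1 + ‖x‖ ^ 2) := by
  nlinarith [norm_sub_le x y, norm_nonneg (x - y), sq_nonneg (1 - ‖x‖ * ‖y‖)]

/-- The mean of a density as a vector of `ℝᵈ`. -/
def meanVec (ρ : E d → ℝ) : E d := WithLp.toLp 2 (mean ρ)

/-- `ρ` is a normalized, possibly signed, density with finite second moment, mean `m` and covariance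
matrix `C`. -/
structure HasMoments (ρ : E d → ℝ) (m : E d) (C : Matrix (Fin d) (Fin d) ℝ) : Prop where
  integral_eq_one : ∫ x, ρ x = 1
  integrable_sq : Integrable fun x => ‖x‖ ^ 2 * ρ x
  mean_eq : ∀ i, mean ρ i = m i
  cov_eq : cov ρ = C

variable {ρ ρ₀ : E d → ℝ} {m : E d} {C : Matrix (Fin d) (Fin d) ℝ}

theorem IsSmoothPosDensity.hasMoments (h : IsSmoothPosDensity ρ) :
    HasMoments ρ (meanVec ρ) (cov ρ) :=
  ⟨h.integral_eq_one, h.second_moment, fun _ => rfl, rfl⟩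

namespace HasMoments

theorem integrable (h : HasMoments ρ m C) : Integrable ρ := by
  by_contra hρ
  exact zero_ne_one ((integral_undef hρ).symm.trans h.integral_eq_one)

theorem meanVec_eq (h : HasMoments ρ m C) : meanVec ρ = m :=
  PiLp.ext h.mean_eq

theorem congr_ae (h : HasMoments ρ m C) (hρ : ρ =ᵐ[volume] ρ₀) : HasMoments ρ₀ m C := by
  have hmul : ∀ w : E d → ℝ, (fun x => w x * ρ x) =ᵐ[volume] fun x => w x * ρ₀ x := fun w => by
    filter_upwards [hρ] with x hx
    rw [hx]
  have hmean : mean ρ₀ = mean ρ := funext fun i => (integral_congr_ae (hmul fun x => x i)).symm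
  refine ⟨(integral_congr_ae hρ).symm.trans h.integral_eq_one, h.integrable_sq.congr (hmul _),
    fun i => by rw [hmean, h.mean_eq], ?_⟩
  rw [← h.cov_eq]
  ext i j
  simp only [cov, hmean, Matrix.of_apply]
  exact (integral_congr_ae (hmul _)).symm

theorem integrable_quadForm (h : HasMoments ρ m C) (Q : Matrix (Fin d) (Fin d) ℝ) (y : E d) :
    Integrable fun x => quadForm Q (x - y) * ρ x := by
  refine integrable_mul_of_abs_le h.integrable h.integrable_sq
    ((continuous_quadForm Q).comp (continuous_sub_right y)) (K := ‖actL Q‖ * (1 + ‖y‖ ^ 2))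
    fun x => ?_
  calc |quadForm Q (x - y)| ≤ ‖actL Q‖ * ‖x - y‖ ^ 2 := abs_quadForm_le Q _
    _ ≤ ‖actL Q‖ * ((1 + ‖y‖ ^ 2) * (1 + ‖x‖ ^ 2)) := by gcongr; exact norm_sub_sq_le x y
    _ = _ := by ring

theorem integrable_inner (h : HasMoments ρ m C) (l y : E d) :
    Integrable fun x => inner ℝ l (x - y) * ρ x := by
  refine integrable_mul_of_abs_le h.integrable h.integrable_sq
    (continuous_const.inner (continuous_sub_right y)) (K := ‖l‖ * (1 + ‖y‖ ^ 2)) fun x => ?_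
  have hxy : ‖x - y‖ ≤ (1 + ‖y‖ ^ 2) * (1 + ‖x‖ ^ 2) := by
    nlinarith [norm_sub_sq_le x y, sq_nonneg (‖x - y‖ - 1), sq_nonneg ‖x‖, sq_nonneg ‖y‖,
      mul_nonneg (sq_nonneg ‖x‖) (sq_nonneg ‖y‖)]
  calc |inner ℝ l (x - y)| ≤ ‖l‖ * ‖x - y‖ := abs_real_inner_le_norm _ _
    _ ≤ ‖l‖ * ((1 + ‖y‖ ^ 2) * (1 + ‖x‖ ^ 2)) := by gcongr
    _ = _ := by ring

theorem integrable_quadratic (h : HasMoments ρ m C) (Q : Matrix (Fin d) (Fin d) ℝ) (l : E d)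
    (k : ℝ) : Integrable fun x => (quadForm Q (x - m) + inner ℝ l (x - m) + k) * ρ x := by
  simp only [add_mul]
  exact ((h.integrable_quadForm Q m).add (h.integrable_inner l m)).add (h.integrable.const_mul k)

theorem integral_coord_mul_coord (h : HasMoments ρ m C) (i j : Fin d) :
    ∫ x, (x - m) i * (x - m) j * ρ x = C i j := by
  simp only [← h.cov_eq, cov, Matrix.of_apply, h.mean_eq, PiLp.sub_apply]

theorem integrable_coord_mul_coord (h : HasMoments ρ m C) (i j : Fin d) :
    Integrable fun x => (x - m) i * (x - m) j * ρ x := by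
  refine (h.integrable_quadForm (Matrix.single i j 1) m).congr (.of_forall fun x => ?_)
  simp [quadForm_eq_sum, Matrix.single_apply, ite_and]

theorem integral_coord (h : HasMoments ρ m C) (i : Fin d) : ∫ x, (x - m) i * ρ x = 0 := by
  have hi : Integrable fun x : E d => x i * ρ x := by
    simpa [EuclideanSpace.inner_single_left] using
      h.integrable_inner (EuclideanSpace.single i 1) 0
  simp only [PiLp.sub_apply, sub_mul]
  rw [integral_sub hi (h.integrable.const_mul _), integral_const_mul, h.integral_eq_one, mul_one,
    ← h.mean_eq]
  exact sub_self _

theorem integral_inner (h : HasMoments ρ m C) (l : E d) :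
    ∫ x, inner ℝ l (x - m) * ρ x = 0 := by
  have hi : ∀ i, Integrable fun x => (x - m) i * l i * ρ x := fun i => by
    simpa [EuclideanSpace.inner_single_left, mul_comm] using
      h.integrable_inner (EuclideanSpace.single i (l i)) m
  simp only [PiLp.inner_apply, RCLike.inner_apply, conj_trivial, Finset.sum_mul]
  rw [integral_finsetSum _ fun i _ => hi i]
  refine Finset.sum_eq_zero fun i _ => ?_
  simp only [mul_right_comm _ (l i), integral_mul_const, h.integral_coord, zero_mul]

theorem integral_quadForm (h : HasMoments ρ m C) (Q : Matrix (Fin d) (Fin d) ℝ) :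
    ∫ x, quadForm Q (x - m) * ρ x = (Q * Cᵀ).trace := by
  have hi : ∀ i j, Integrable fun x => Q i j * ((x - m) i * (x - m) j) * ρ x := fun i j => by
    simpa only [mul_assoc] using (h.integrable_coord_mul_coord i j).const_mul (Q i j)
  simp only [quadForm_eq_sum, Finset.sum_mul]
  rw [integral_finsetSum _ fun i _ => integrable_finsetSum _ fun j _ => hi i j]
  simp only [Matrix.trace, Matrix.diag_apply, Matrix.mul_apply, Matrix.transpose_apply]
  refine Finset.sum_congr rfl fun i _ => ?_
  rw [integral_finsetSum _ fun j _ => hi i j]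
  refine Finset.sum_congr rfl fun j _ => ?_
  simp only [mul_assoc (Q i j), integral_const_mul, h.integral_coord_mul_coord]

theorem integral_quadratic (h : HasMoments ρ m C) (Q : Matrix (Fin d) (Fin d) ℝ) (l : E d)
    (k : ℝ) :
    ∫ x, (quadForm Q (x - m) + inner ℝ l (x - m) + k) * ρ x = (Q * Cᵀ).trace + k := by
  have hQ := h.integrable_quadForm Q m
  have hl := h.integrable_inner l m
  have hQl : Integrable fun x => quadForm Q (x - m) * ρ x + inner ℝ l (x - m) * ρ x := hQ.add hl
  simp only [add_mul]
  rw [integral_add hQl (h.integrable.const_mul k), integral_add hQ hl, h.integral_quadForm,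
    h.integral_inner, integral_const_mul, h.integral_eq_one, add_zero, mul_one]

theorem integrable_quadForm_affine (h : HasMoments ρ m C) (K B : Matrix (Fin d) (Fin d) ℝ)
    (b : E d) : Integrable fun x => quadForm K (act B x + b) * ρ x := by
  rw [funext fun x => congrArg (· * ρ x) (quadForm_act_add_recenter B x b K m)]
  exact h.integrable_quadratic _ _ _

theorem integral_quadForm_affine (h : HasMoments ρ m C) (K B : Matrix (Fin d) (Fin d) ℝ)
    (b : E d) : ∫ x, quadForm K (act B x + b) * ρ x =
      (Bᵀ * K * B * Cᵀ).trace + quadForm K (act B m + b) := by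
  rw [funext fun x => congrArg (· * ρ x) (quadForm_act_add_recenter B x b K m)]
  exact h.integral_quadratic _ _ _

theorem transport (h : HasMoments ρ₀ m C) {A : Matrix (Fin d) (Fin d) ℝ} (hA : A.det ≠ 0) {a : E d}
    (hρ : ∀ y, |A.det| * ρ (act A y + a) = ρ₀ y) :
    HasMoments ρ (act A m + a) (A * C * Aᵀ) := by
  have hpush : ∀ (w : E d → ℝ) y,
      |A.det| • (w (act A y + a) * ρ (act A y + a)) = w (act A y + a) * ρ₀ y := fun w y => by
    rw [← hρ, smul_eq_mul]
    ring
  have hintegral : ∀ w : E d → ℝ, ∫ x, w x * ρ x = ∫ y, w (act A y + a) * ρ₀ y := fun w => by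
    rw [← integral_comp_act_add hA a]
    simp only [hpush]
  have hcoord : ∀ (y : E d) i, (act A y + a) i - (act A m + a) i =
      inner ℝ (WithLp.toLp 2 (A i)) (y - m) := fun y i => by
    simp only [PiLp.inner_apply, RCLike.inner_apply, conj_trivial, PiLp.add_apply, act_apply,
      PiLp.sub_apply, sub_mul, Finset.sum_sub_distrib, mul_comm (A i _)]
    ring
  have hmean : ∀ i, mean ρ i = (act A m + a) i := fun i => by
    have := h.integral_quadratic 0 (WithLp.toLp 2 (A i)) ((act A m + a) i)
    simpa only [mean, quadForm, Matrix.zero_mulVec, dotProduct_zero, zero_add, zero_mul,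
      Matrix.trace_zero, ← hcoord, sub_add_cancel, ← hintegral fun x => x i] using this
  refine ⟨?_, ?_, hmean, ?_⟩
  · simpa only [one_mul, h.integral_eq_one] using hintegral fun _ => 1
  · rw [← integrable_comp_act_add_iff hA a]
    simp only [hpush fun x => ‖x‖ ^ 2]
    simpa only [quadForm_one] using h.integrable_quadForm_affine 1 A a
  · ext i j
    have hQ : ∀ y, inner ℝ (WithLp.toLp 2 (A i)) (y - m) * inner ℝ (WithLp.toLp 2 (A j)) (y - m) =
        quadForm (Matrix.vecMulVec (A i) (A j)) (y - m) := fun y => by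
      simp only [PiLp.inner_apply, RCLike.inner_apply, conj_trivial, quadForm_eq_sum,
        Matrix.vecMulVec_apply, Finset.sum_mul_sum]
      exact Finset.sum_congr rfl fun k _ => Finset.sum_congr rfl fun l _ => by ring
    simp only [cov, Matrix.of_apply, hmean,
      hintegral fun x => (x i - (act A m + a) i) * (x j - (act A m + a) j), hcoord, hQ,
      h.integral_quadForm]
    simp only [Matrix.trace, Matrix.diag_apply, Matrix.mul_apply, Matrix.vecMulVec_apply,
      Matrix.transpose_apply, Finset.sum_mul]
    rw [Finset.sum_comm]
    exact Finset.sum_congr rfl fun k _ => Finset.sum_congr rfl fun l _ => by ring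

end HasMoments

end Moments

/-! ### The closed form in an orthonormal basis of common eigenvectors -/

/-- The eigenvalue of `κ Ξ` that belongs to the eigenvalues `p` of `κ Σ₀` and `q` of `κ Σ₁`. -/
def xiScalar (lam p q : ℝ) : ℝ :=
  q * Real.log (q / p) + (q + lam) * Real.log ((p + lam) / (q + lam))

/-- The contribution to the divergence of one coordinate, in which the variances are `p`, `q`, and
the means differ by `δ`. -/
def coordValue (lam p q δ : ℝ) : ℝ :=
  xiScalar lam p q / (4 * lam) +
    if p = q then δ ^ 2 / (2 * (p + lam))
    else xiScalar lam p q / (4 * lam) * δ ^ 2 / (√q - √p) ^ 2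

section ClosedForm

variable {d : ℕ} (U : Matrix.unitaryGroup (Fin d) ℝ) {a b : Fin d → ℝ} {κ lam : ℝ}

theorem inflate_odiag (a : Fin d → ℝ) :
    inflate κ lam (odiag U a) = odiag U fun i => κ * a i + lam := by
  rw [inflate, ← map_one (odiag U), ← map_smul, ← map_smul, ← map_add]
  congr 1
  ext i
  simp only [Pi.add_apply, Pi.smul_apply, Pi.one_apply, smul_eq_mul, mul_one]

theorem proj_odiag (a b : Fin d → ℝ) :
    proj (odiag U a) (odiag U b) = odiag U ((b - a) * (b - a)⁻¹) := by
  rw [proj, pinv, ← map_sub, cfc_odiag, ← map_mul]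
  rfl

theorem projPerp_odiag (a b : Fin d → ℝ) :
    projPerp (odiag U a) (odiag U b) = odiag U (1 - (b - a) * (b - a)⁻¹) := by
  rw [projPerp, proj_odiag, map_sub, map_one]

theorem Xi_odiag (ha : ∀ i, 0 < a i) (hb : ∀ i, 0 < b i) (hκ : 0 < κ) (hlam : 0 < lam) :
    Xi κ lam (odiag U a) (odiag U b) =
      odiag U fun i => κ⁻¹ * xiScalar lam (κ * a i) (κ * b i) := by
  have hb' : ∀ i, κ * b i + lam ≠ 0 := fun i =>
    (add_pos (mul_pos hκ (hb i)) hlam).ne'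
  rw [Xi, inflate_odiag, inflate_odiag, odiag_inv U fun i => (ha i).ne', odiag_inv U hb', ← map_mul,
    ← map_mul, mlog, mlog, cfc_odiag, cfc_odiag, ← map_mul, ← map_mul, ← map_smul, ← map_add]
  congr 1
  ext i
  simp only [Pi.add_apply, Pi.mul_apply, Pi.smul_apply, Function.comp_apply, Pi.inv_apply,
    smul_eq_mul, xiScalar, mul_div_mul_left _ _ hκ.ne', div_eq_mul_inv]
  field_simp

theorem pinv_msqrt_sub_odiag (a b : Fin d → ℝ) :
    pinv (msqrt (odiag U b) - msqrt (odiag U a)) = odiag U fun i => (√(b i) - √(a i))⁻¹ := by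
  rw [msqrt, msqrt, cfc_odiag, cfc_odiag, ← map_sub, pinv, cfc_odiag]
  rfl

theorem closedForm_eq_coordValue {p q : ℝ} (hp : 0 < p) (hq : 0 < q) (hκ : 0 < κ) (hlam : 0 < lam)
    (δ : ℝ) :
    κ / (4 * lam) * (κ⁻¹ * xiScalar lam (κ * p) (κ * q)) + 1 / 2 *
      (((1 - (q - p) * (q - p)⁻¹) * (κ * p + lam)⁻¹ * (1 - (q - p) * (q - p)⁻¹) +
        1 / (2 * lam) * ((q - p) * (q - p)⁻¹ * (κ⁻¹ * xiScalar lam (κ * p) (κ * q)) *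
          ((q - p) * (q - p)⁻¹) * (√q - √p)⁻¹ ^ 2)) * δ ^ 2) =
      coordValue lam (κ * p) (κ * q) δ := by
  have hne : κ * p + lam ≠ 0 := by positivity
  by_cases hpq : p = q
  · subst hpq
    rw [coordValue, if_pos rfl, sub_self, zero_mul]
    field_simp
    ring
  · have hsqrt : √q - √p ≠ 0 := fun h =>
      hpq ((Real.sqrt_inj hp.le hq.le).mp (sub_eq_zero.mp h).symm)
    have hscale : (√(κ * q) - √(κ * p)) ^ 2 = κ * (√q - √p) ^ 2 := by
      rw [Real.sqrt_mul hκ.le, Real.sqrt_mul hκ.le, ← mul_sub, mul_pow, Real.sq_sqrt hκ.le]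
    rw [coordValue, if_neg fun h => hpq (mul_left_cancel₀ hκ.ne' h), hscale,
      mul_inv_cancel₀ (sub_ne_zero.mpr (Ne.symm hpq))]
    field_simp
    ring

theorem closedForm_eq_sum (ha : ∀ i, 0 < a i) (hb : ∀ i, 0 < b i) (hκ : 0 < κ) (hlam : 0 < lam)
    (x : E d) :
    κ / (4 * lam) * (Xi κ lam (odiag U a) (odiag U b)).trace +
        1 / 2 * quadForm
          (projPerp (odiag U a) (odiag U b) * (inflate κ lam (odiag U a))⁻¹ *
              projPerp (odiag U a) (odiag U b) +
            (1 / (2 * lam)) • (proj (odiag U a) (odiag U b) * Xi κ lam (odiag U a) (odiag U b) *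
              proj (odiag U a) (odiag U b) *
              pinv (msqrt (odiag U b) - msqrt (odiag U a)) ^ 2)) x =
      ∑ i, coordValue lam (κ * a i) (κ * b i) (act U.1ᵀ x i) := by
  have ha' : ∀ i, κ * a i + lam ≠ 0 := fun i => (add_pos (mul_pos hκ (ha i)) hlam).ne'
  rw [projPerp_odiag, proj_odiag, inflate_odiag, odiag_inv U ha', Xi_odiag U ha hb hκ hlam,
    pinv_msqrt_sub_odiag]
  simp only [← map_mul, ← map_pow, ← map_smul, ← map_add]
  rw [odiag_trace, quadForm_odiag, Finset.mul_sum, Finset.mul_sum, ← Finset.sum_add_distrib]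
  exact Finset.sum_congr rfl fun i _ => closedForm_eq_coordValue (ha i) (hb i) hκ hlam _

end ClosedForm

/-! ### Elliptic densities -/

section Radial

variable {d : ℕ} (φ : ℝ → ℝ)

theorem integral_coord_mul_radial (i : Fin d) : ∫ y : E d, y i * φ ‖y‖ = 0 := by
  have hneg := integral_neg_eq_self (fun y : E d => y i * φ ‖y‖) volume
  simp only [norm_neg, PiLp.neg_apply, neg_mul, integral_neg] at hneg
  linarith

theorem integral_isometry_comp_mul_radial (T : E d ≃ₗᵢ[ℝ] E d) (w : E d → ℝ) :
    ∫ y, w (T y) * φ ‖y‖ = ∫ y, w y * φ ‖y‖ := by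
  simpa only [T.norm_map] using T.measurePreserving.integral_comp
    T.toHomeomorph.measurableEmbedding fun y => w y * φ ‖y‖

theorem integral_coord_mul_coord_mul_radial_of_ne {i j : Fin d} (hij : i ≠ j) :
    ∫ y : E d, y i * y j * φ ‖y‖ = 0 := by
  let flip : E d ≃ₗᵢ[ℝ] E d := LinearIsometryEquiv.piLpCongrRight 2
    fun k => if k = i then LinearIsometryEquiv.neg ℝ else LinearIsometryEquiv.refl ℝ ℝ
  have hi : ∀ y, flip y i = -y i := fun y => by
    simp [flip, LinearIsometryEquiv.piLpCongrRight_apply]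
  have hj : ∀ y, flip y j = y j := fun y => by
    simp [flip, LinearIsometryEquiv.piLpCongrRight_apply, hij.symm]
  have hflip := integral_isometry_comp_mul_radial φ flip fun y => y i * y j
  simp only [hi, hj, neg_mul, integral_neg] at hflip
  linarith

theorem integral_coord_sq_mul_radial_eq (i j : Fin d) :
    ∫ y : E d, y i ^ 2 * φ ‖y‖ = ∫ y : E d, y j ^ 2 * φ ‖y‖ := by
  let swap : E d ≃ₗᵢ[ℝ] E d := LinearIsometryEquiv.piLpCongrLeft 2 ℝ ℝ (Equiv.swap i j)
  have hi : ∀ y, swap y j = y i := fun y => by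
    simp [swap, LinearIsometryEquiv.piLpCongrLeft_apply, Equiv.piCongrLeft'_apply]
  simpa only [hi] using integral_isometry_comp_mul_radial φ swap fun y => y j ^ 2

variable {φ}

theorem integral_coord_sq_mul_radial (h₀ : Integrable fun y : E d => φ ‖y‖)
    (h₂ : Integrable fun y : E d => ‖y‖ ^ 2 * φ ‖y‖) (i : Fin d) :
    ∫ y : E d, y i ^ 2 * φ ‖y‖ = 1 / d * ∫ y : E d, ‖y‖ ^ 2 * φ ‖y‖ := by
  have hint : ∀ j, Integrable fun y : E d => y j ^ 2 * φ ‖y‖ := fun j =>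
    integrable_mul_of_abs_le h₀ h₂ (by fun_prop) (K := 1) fun y => by
      rw [one_mul, abs_pow, ← Real.norm_eq_abs]
      have := pow_le_pow_left₀ (norm_nonneg _) (PiLp.norm_apply_le y j) 2
      linarith
  have hd : (d : ℝ) ≠ 0 := Nat.cast_ne_zero.mpr i.pos.ne'
  have hsum : ∫ y : E d, ‖y‖ ^ 2 * φ ‖y‖ = ∑ j, ∫ y : E d, y j ^ 2 * φ ‖y‖ := by
    simp only [← integral_finsetSum _ fun j _ => hint j, ← Finset.sum_mul,
      ← EuclideanSpace.real_norm_sq_eq]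
  rw [hsum, Finset.sum_congr rfl fun j _ => integral_coord_sq_mul_radial_eq φ j i, Finset.sum_const,
    Finset.card_univ, Fintype.card_fin, nsmul_eq_mul]
  field_simp

end Radial

theorem rpow_two_substitution (s : ℝ) {x : ℝ} (hx : 0 < x) (g : ℝ → ℝ) :
    x ^ ((2 : ℝ) - 1) • ((x ^ (2 : ℝ)) ^ s * g (x ^ (2 : ℝ))) = x ^ (2 * s + 1) * g (x ^ 2) := by
  rw [← Real.rpow_mul hx.le, Real.rpow_two, smul_eq_mul, ← mul_assoc, ← Real.rpow_add hx]
  ring_nf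

theorem integral_comp_norm_sq {d : ℕ} (hd : 0 < d) (g : ℝ → ℝ) :
    ∫ y : E d, g (‖y‖ ^ 2) = Real.pi ^ ((d : ℝ) / 2) / Real.Gamma ((d : ℝ) / 2) *
      ∫ r in Ioi (0 : ℝ), r ^ ((d : ℝ) / 2 - 1) * g r := by
  have : Nonempty (Fin d) := ⟨⟨0, hd⟩⟩
  have hd' : (0 : ℝ) < d / 2 := by positivity
  have hpi : √Real.pi ^ d = Real.pi ^ ((d : ℝ) / 2) := by
    rw [Real.sqrt_eq_rpow, ← Real.rpow_natCast, ← Real.rpow_mul Real.pi_pos.le]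
    ring_nf
  have hsubst : ∫ r in Ioi (0 : ℝ), r ^ ((d : ℝ) / 2 - 1) * g r =
      2 * ∫ x in Ioi (0 : ℝ), x ^ (d - 1) • g (x ^ 2) := by
    rw [← integral_comp_rpow_Ioi_of_pos two_pos, ← integral_const_mul]
    refine setIntegral_congr_fun measurableSet_Ioi fun x hx => ?_
    have hexp : x ^ (2 * ((d : ℝ) / 2 - 1) + 1) = x ^ (d - 1) := by
      rw [← Real.rpow_natCast, Nat.cast_sub (Nat.one_le_iff_ne_zero.mpr hd.ne')]
      push_cast
      ring_nf
    rw [mul_smul, rpow_two_substitution _ hx, hexp, smul_eq_mul, smul_eq_mul]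
  have hne := (Real.Gamma_pos_of_pos hd').ne'
  rw [integral_fun_norm_addHaar volume fun r => g (r ^ 2), hsubst, finrank_euclideanSpace,
    Fintype.card_fin, Measure.real, EuclideanSpace.volume_ball, Fintype.card_fin,
    ENNReal.ofReal_one, one_pow, one_mul, Real.Gamma_add_one hd'.ne', hpi,
    ENNReal.toReal_ofReal (by positivity), nsmul_eq_mul, smul_eq_mul]
  field_simp

section Elliptic

variable {d : ℕ} {g : ℝ → ℝ}

namespace IsGenerator

theorem dim_pos (h : IsGenerator d g) : 0 < d := by
  rcases Nat.eq_zero_or_pos d with rfl | hd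
  · simpa [Real.Gamma_zero] using h.normalized
  · exact hd

theorem integrable_sq_isotropic (h : IsGenerator d g) :
    Integrable fun y : E d => ‖y‖ ^ 2 * g (‖y‖ ^ 2) := by
  have hd := h.dim_pos
  have : Nonempty (Fin d) := ⟨⟨0, hd⟩⟩
  rw [integrable_fun_norm_addHaar volume (f := fun r => r ^ 2 * g (r ^ 2))]
  refine ((integrableOn_Ioi_comp_rpow_iff' _ two_ne_zero).mpr h.finite_variance).congr_fun
    (fun x hx => ?_) measurableSet_Ioi
  have hexp : x ^ (2 * ((d : ℝ) / 2) + 1) = x ^ (d - 1) * x ^ 2 := by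
    rw [← pow_add, show d - 1 + 2 = d + 1 by lia, ← Real.rpow_natCast]
    push_cast
    ring_nf
  beta_reduce
  rw [rpow_two_substitution _ hx, finrank_euclideanSpace, Fintype.card_fin, smul_eq_mul,
    ← mul_assoc, hexp]

theorem isSmoothPosDensity_isotropic (h : IsGenerator d g) :
    IsSmoothPosDensity fun y : E d => g (‖y‖ ^ 2) where
  smooth := contDiffOn_univ.mp <|
    h.smooth.comp (contDiff_norm_sq ℝ).contDiffOn fun y _ => sq_nonneg ‖y‖
  pos _ := h.pos _ (sq_nonneg _)
  integral_eq_one := (integral_comp_norm_sq h.dim_pos g).trans h.normalized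
  second_moment := h.integrable_sq_isotropic

theorem hasMoments_isotropic (h : IsGenerator d g) :
    HasMoments (fun y : E d => g (‖y‖ ^ 2)) 0 (kappa d g • 1) := by
  have hρ := h.isSmoothPosDensity_isotropic.hasMoments
  let φ : ℝ → ℝ := fun r => g (r ^ 2)
  have hmean : ∀ i, mean (fun y : E d => g (‖y‖ ^ 2)) i = 0 := integral_coord_mul_radial φ
  refine ⟨hρ.integral_eq_one, hρ.integrable_sq, hmean, ?_⟩
  ext i j
  simp only [cov, kappa, hmean, sub_zero, Matrix.of_apply, Matrix.smul_apply]
  rcases eq_or_ne i j with rfl | hij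
  · simpa only [Matrix.one_apply_eq, smul_eq_mul, mul_one, ← sq] using
      integral_coord_sq_mul_radial (φ := φ) hρ.integrable hρ.integrable_sq i
  · simpa only [Matrix.one_apply_ne hij, smul_zero] using
      integral_coord_mul_coord_mul_radial_of_ne φ hij

theorem kappa_pos (h : IsGenerator d g) : 0 < kappa d g := by
  have hd := h.dim_pos
  have : Nonempty (Fin d) := ⟨⟨0, hd⟩⟩
  have hnn : 0 ≤ fun y : E d => ‖y‖ ^ 2 * g (‖y‖ ^ 2) := fun y =>
    mul_nonneg (sq_nonneg _) (h.pos _ (sq_nonneg _)).le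
  have hsupp : (Function.support fun y : E d => ‖y‖ ^ 2 * g (‖y‖ ^ 2)) = {0}ᶜ := by
    ext y
    simp [(h.pos _ (sq_nonneg ‖y‖)).ne']
  refine mul_pos (by positivity) ?_
  rw [integral_pos_iff_support_of_nonneg hnn h.integrable_sq_isotropic, hsupp]
  exact isOpen_compl_singleton.measure_pos volume (exists_ne (0 : E d))

end IsGenerator

variable {S R : Matrix (Fin d) (Fin d) ℝ}

theorem ellipticDensity_mul_self (hR : R.PosDef) (m x : E d) :
    ellipticDensity m (R * R) g x = R.det⁻¹ * g (‖act R⁻¹ (x - m)‖ ^ 2) := by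
  have hdet : (R * R).det ^ (-(1 / 2) : ℝ) = R.det⁻¹ := by
    rw [Matrix.det_mul, Real.rpow_neg (mul_self_nonneg _), ← Real.sqrt_eq_rpow,
      Real.sqrt_mul_self hR.det_pos.le]
  have hsymm : R⁻¹ᵀ = R⁻¹ := by
    rw [Matrix.transpose_nonsing_inv, ← Matrix.conjTranspose_eq_transpose_of_trivial,
      hR.isHermitian.eq]
  rw [ellipticDensity, hdet, Matrix.mul_inv_rev, quadForm_eq_inner, act_mul, inner_act_right, hsymm,
    real_inner_self_eq_norm_sq]

theorem hasMoments_ellipticDensity (h : IsGenerator d g) (hS : S.PosDef) (m : E d) :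
    HasMoments (ellipticDensity m S g) m (kappa d g • S) := by
  obtain ⟨R, hR, rfl⟩ := exists_posDef_mul_self_eq hS
  have hu : IsUnit R.det := hR.det_pos.ne'.isUnit
  have hpush := h.hasMoments_isotropic.transport (ρ := ellipticDensity m (R * R) g)
    hR.det_pos.ne' (a := m) fun y => by
      rw [ellipticDensity_mul_self hR, add_sub_cancel_right, ← act_mul, Matrix.nonsing_inv_mul R hu,
        act_one, abs_of_pos hR.det_pos, mul_inv_cancel_left₀ hR.det_pos.ne']
  have hzero : act R 0 + m = m := by rw [← actL_apply, map_zero, zero_add]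
  rwa [hzero, Matrix.mul_smul, Matrix.smul_mul, mul_one,
    ← Matrix.conjTranspose_eq_transpose_of_trivial, hR.isHermitian.eq] at hpush

theorem isSmoothPosDensity_ellipticDensity (h : IsGenerator d g) (hS : S.PosDef) (m : E d) :
    IsSmoothPosDensity (ellipticDensity m S g) := by
  have hM := hasMoments_ellipticDensity h hS m
  obtain ⟨R, hR, rfl⟩ := exists_posDef_mul_self_eq hS
  refine ⟨?_, fun x => ?_, hM.integral_eq_one, hM.integrable_sq⟩
  · rw [funext (ellipticDensity_mul_self hR m)]
    exact contDiff_const.mul <| h.isSmoothPosDensity_isotropic.smooth.comp <|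
      (actL R⁻¹).contDiff.comp (contDiff_id.sub contDiff_const)
  · rw [ellipticDensity_mul_self hR]
    exact mul_pos (inv_pos.mpr hR.det_pos) (h.pos _ (sq_nonneg _))

theorem ae_eq_of_ofDensity_eq {ρ ρ' : E d → ℝ} (h : IsSmoothPosDensity ρ)
    (h' : IsSmoothPosDensity ρ') (he : ofDensity ρ = ofDensity ρ') : ρ =ᵐ[volume] ρ' := by
  have hofReal := (withDensity_eq_iff_of_sigmaFinite
    h.smooth.continuous.measurable.ennreal_ofReal.aemeasurable
    h'.smooth.continuous.measurable.ennreal_ofReal.aemeasurable).mp he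
  filter_upwards [hofReal] with x hx
  exact (ENNReal.ofReal_eq_ofReal_iff (h.pos x).le (h'.pos x).le).mp hx

end Elliptic

/-! ### The continuity equation with an affine velocity field -/

section Quadratic

variable {d : ℕ} {f : E d → ℝ} {B : Matrix (Fin d) (Fin d) ℝ} {b : E d} {c lam : ℝ}

theorem hasGradientAt_quadratic (hB : B.IsSymm) (b : E d) (c : ℝ) (x : E d) :
    HasGradientAt (fun x => 1 / 2 * quadForm B x + inner ℝ b x + c) (act B x + b) x := by
  rw [hasGradientAt_iff_hasFDerivAt]
  have hquad := (hasFDerivAt_id (𝕜 := ℝ) x).inner ℝ (actL B).hasFDerivAt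
  have hlin : HasFDerivAt (fun x : E d => inner ℝ b x) (innerSL ℝ b) x := (innerSL ℝ b).hasFDerivAt
  simp only [quadForm_eq_inner]
  refine (((hquad.const_mul (1 / 2)).add hlin).add_const c).congr_fderiv ?_
  ext y
  have hsymm : inner ℝ x (act B y) = inner ℝ (act B x) y := by rw [inner_act_right, hB.eq]
  simp only [one_div, id_eq, actL_apply, add_apply, smul_apply, ContinuousLinearMap.comp_apply,
    ContinuousLinearMap.prod_apply, ContinuousLinearMap.id_apply, fderivInnerCLM_apply, hsymm,
    smul_eq_mul, coe_innerSL_apply, map_add, InnerProductSpace.toDual_apply_apply]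
  rw [real_inner_comm y (act B x)]
  ring

theorem contDiff_quadratic (B : Matrix (Fin d) (Fin d) ℝ) (b : E d) (c : ℝ) :
    ContDiff ℝ ∞ fun x : E d => 1 / 2 * quadForm B x + inner ℝ b x + c := by
  simp only [quadForm_eq_inner, ← actL_apply]
  exact ((contDiff_const.mul (contDiff_id.inner ℝ (actL B).contDiff)).add
    (contDiff_const.inner ℝ contDiff_id)).add contDiff_const

/-- The matrix of the affine velocity field that belongs to a quadratic potential. -/
def velMat (lam : ℝ) (C B : Matrix (Fin d) (Fin d) ℝ) : Matrix (Fin d) (Fin d) ℝ :=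
  (C + lam • 1) * B

/-- The constant part of the affine velocity field that belongs to a quadratic potential. -/
def velVec (lam : ℝ) (C : Matrix (Fin d) (Fin d) ℝ) (b : E d) : E d :=
  act (C + lam • 1) b

theorem gradient_quadratic (hB : B.IsSymm)
    (hf : ∀ x, f x = 1 / 2 * quadForm B x + inner ℝ b x + c) (x : E d) :
    gradient f x = act B x + b := by
  rw [funext hf]
  exact (hasGradientAt_quadratic hB b c x).gradient

theorem velocity_quadratic (hB : B.IsSymm)
    (hf : ∀ x, f x = 1 / 2 * quadForm B x + inner ℝ b x + c) (ρ : E d → ℝ) (x : E d) :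
    velocity lam ρ f x = act (velMat lam (cov ρ) B) x + velVec lam (cov ρ) b := by
  rw [velocity, gradient_quadratic hB hf, act_add, velMat, velVec, act_mul]

theorem divergence_smul_affine {ρ : E d → ℝ} {x : E d} (hρ : DifferentiableAt ℝ ρ x)
    (M : Matrix (Fin d) (Fin d) ℝ) (w : E d) :
    divergence (fun y => ρ y • (act M y + w)) x =
      fderiv ℝ ρ x (act M x + w) + ρ x * M.trace := by
  have hcoord : ∀ i, fderiv ℝ (fun y => (ρ y • (act M y + w)) i) x (EuclideanSpace.single i 1) =
      (act M x + w) i * fderiv ℝ ρ x (EuclideanSpace.single i 1) + ρ x * M i i := fun i => by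
    have haff : HasFDerivAt (fun y => (act M y + w) i)
        ((EuclideanSpace.proj i : E d →L[ℝ] ℝ).comp (actL M)) x :=
      (EuclideanSpace.proj i : E d →L[ℝ] ℝ).hasFDerivAt.comp x (hasFDerivAt_act_add M w x)
    have hMii : (EuclideanSpace.proj i : E d →L[ℝ] ℝ) (actL M (EuclideanSpace.single i 1)) =
        M i i := by
      simp [actL_apply, act_apply]
    refine (DFunLike.congr_fun (hρ.hasFDerivAt.mul haff).fderiv _).trans ?_
    simp only [add_apply, smul_apply, ContinuousLinearMap.comp_apply, smul_eq_mul, hMii]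
    ring
  have hexpand : act M x + w = ∑ i, (act M x + w) i • EuclideanSpace.single i (1 : ℝ) := by
    ext j
    simp [Pi.single_apply]
  rw [divergence, Finset.sum_congr rfl fun i _ => hcoord i, Finset.sum_add_distrib, Matrix.trace,
    Finset.mul_sum]
  conv_rhs => rw [hexpand, map_sum]
  simp only [map_smul, smul_eq_mul, Matrix.diag_apply]

theorem inertia_quadratic (hB : B.IsSymm)
    (hf : ∀ x, f x = 1 / 2 * quadForm B x + inner ℝ b x + c) {ρ : E d → ℝ} {x : E d}
    (hρ : DifferentiableAt ℝ ρ x) :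
    inertia lam ρ f x =
      -(fderiv ℝ ρ x (act (velMat lam (cov ρ) B) x + velVec lam (cov ρ) b) +
        ρ x * (velMat lam (cov ρ) B).trace) := by
  rw [inertia, ← divergence_smul_affine hρ, funext (velocity_quadratic hB hf ρ)]

end Quadratic

theorem hasDerivWithinAt_along_curve {V : Type*} [NormedAddCommGroup V] [NormedSpace ℝ V]
    {F : ℝ → V → ℝ} {X : ℝ → V} {v : V} {τ t : ℝ} {I : Set ℝ} (hI : UniqueDiffWithinAt ℝ I t)
    (ht : t ∈ I) (hF : DifferentiableWithinAt ℝ (fun p : ℝ × V => F p.1 p.2) (I ×ˢ univ) (t, X t))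
    (hτ : HasDerivWithinAt (fun s => F s (X t)) τ I t) (hX : HasDerivWithinAt X v I t) :
    HasDerivWithinAt (fun s => F s (X s)) (τ + fderiv ℝ (F t) (X t) v) I t := by
  set F' := fderivWithin ℝ (fun p : ℝ × V => F p.1 p.2) (I ×ˢ univ) (t, X t)
  have hF' := hF.hasFDerivWithinAt
  have hmaps : ∀ Y : ℝ → V, MapsTo (fun s => (s, Y s)) I (I ×ˢ univ) := fun Y s hs =>
    ⟨hs, mem_univ _⟩
  have hcurve : ∀ {Y : ℝ → V} {y : V}, Y t = X t → HasDerivWithinAt Y y I t →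
      HasDerivWithinAt (fun s => F s (Y s)) (F' (1, y)) I t := fun {Y y} hYt hY =>
    HasFDerivWithinAt.comp_hasDerivWithinAt (l := fun p : ℝ × V => F p.1 p.2) t (by rwa [hYt])
      ((hasDerivAt_id' t).hasDerivWithinAt.prodMk hY) (hmaps Y)
  have htime : F' (1, 0) = τ :=
    hI.eq_deriv _ (hcurve (Y := fun _ => X t) rfl (hasDerivWithinAt_const t I (X t))) hτ
  have hspace : HasFDerivAt (F t) (F'.comp (ContinuousLinearMap.inr ℝ ℝ V)) (X t) := by
    rw [← hasFDerivWithinAt_univ]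
    exact hF'.comp (X t) (hasFDerivAt_prodMk_right t (X t)).hasFDerivWithinAt
      fun x _ => ⟨ht, mem_univ _⟩
  refine (hcurve rfl hX).congr_deriv ?_
  rw [← htime, hspace.fderiv, ContinuousLinearMap.comp_apply, ← map_add]
  simp

section MatrixCurves

open scoped Matrix.Norms.Operator

variable {n : Type*} {A : ℝ → Matrix n n ℝ} {A' : Matrix n n ℝ} {I : Set ℝ} {t : ℝ}

theorem hasDerivWithinAt_transpose [Finite n] (hA : HasDerivWithinAt A A' I t) :
    HasDerivWithinAt (fun s => (A s)ᵀ) A'ᵀ I t := by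
  classical
  have := Fintype.ofFinite n
  exact (LinearMap.toContinuousLinearMap
    (Matrix.transposeLinearEquiv n n ℝ ℝ).toLinearMap).hasFDerivAt.comp_hasDerivWithinAt t hA

variable [Fintype n] [DecidableEq n]

theorem hasDerivWithinAt_matrix_inv (hA : HasDerivWithinAt A A' I t) (hunit : IsUnit (A t)) :
    HasDerivWithinAt (fun s => (A s)⁻¹) (-((A t)⁻¹ * A' * (A t)⁻¹)) I t := by
  obtain ⟨u, hu⟩ := hunit
  have hinv := hasFDerivAt_ringInverse (𝕜 := ℝ) u
  rw [hu] at hinv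
  simp only [Matrix.nonsing_inv_eq_ringInverse]
  refine (hinv.comp_hasDerivWithinAt t hA).congr_deriv ?_
  simp [← hu]

theorem hasDerivAt_det_one_add_smul (M : Matrix n n ℝ) :
    HasDerivAt (fun s : ℝ => (1 + s • M).det) M.trace 0 := by
  have heval : ∀ s : ℝ, (1 + (Polynomial.X : Polynomial ℝ) • M.map Polynomial.C).det.eval s =
      (1 + s • M).det := fun s => by
    rw [← Polynomial.coe_evalRingHom, RingHom.map_det]
    congr 1
    ext i j
    simp [Matrix.one_apply, apply_ite, mul_comm s]
  rw [← Matrix.derivative_det_one_add_X_smul]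
  simpa only [heval] using
    (1 + (Polynomial.X : Polynomial ℝ) • M.map Polynomial.C).det.hasDerivAt 0

theorem contDiff_det : ContDiff ℝ ∞ (Matrix.det : Matrix n n ℝ → ℝ) := by
  have hentry : ∀ i j, ContDiff ℝ ∞ fun A : Matrix n n ℝ => A i j := fun i j =>
    (LinearMap.toContinuousLinearMap (Matrix.entryLinearMap ℝ ℝ i j)).contDiff
  simp only [funext fun A : Matrix n n ℝ => A.det_apply]
  exact ContDiff.sum fun σ _ => (contDiff_prod fun i _ => hentry (σ i) i).const_smul _

theorem hasDerivWithinAt_det {M : Matrix n n ℝ} (hA : HasDerivWithinAt A (M * A t) I t) :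
    HasDerivWithinAt (fun s => (A s).det) (M.trace * (A t).det) I t := by
  have hdet := (contDiff_det.differentiable (by simp) (A t)).hasFDerivAt
  have hline : HasDerivAt (fun s : ℝ => A t + s • (M * A t)) (M * A t) 0 :=
    (((hasDerivAt_id' 0).smul_const _).const_add _).congr_deriv (one_smul ..)
  have hdetline : HasDerivAt (fun s : ℝ => (A t + s • (M * A t)).det) (M.trace * (A t).det) 0 := by
    refine ((hasDerivAt_det_one_add_smul M).mul_const (A t).det).congr_of_eventuallyEq
      (.of_forall fun s => ?_)
    dsimp only
    rw [← Matrix.det_mul, add_mul, one_mul, smul_mul_assoc]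
  refine (hdet.comp_hasDerivWithinAt t hA).congr_deriv (HasDerivAt.unique ?_ hdetline)
  exact HasFDerivAt.comp_hasDerivAt (l := Matrix.det) 0 (by simpa using hdet) hline

end MatrixCurves

section Flow

open scoped Matrix.Norms.Operator

variable {d : ℕ}

theorem hasDerivWithinAt_act {A : ℝ → Matrix (Fin d) (Fin d) ℝ} {A' : Matrix (Fin d) (Fin d) ℝ}
    {I : Set ℝ} {t : ℝ} (hA : HasDerivWithinAt A A' I t) (y : E d) :
    HasDerivWithinAt (fun s => act (A s) y) (act A' y) I t :=
  ((ContinuousLinearMap.apply ℝ (E d) y).comp actL).hasFDerivAt.comp_hasDerivWithinAt t hA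

theorem exists_affine_flow {M : ℝ → Matrix (Fin d) (Fin d) ℝ} {w : ℝ → E d}
    (hM : ContinuousOn M (Icc 0 1)) (hw : ContinuousOn w (Icc 0 1)) :
    ∃ (A : ℝ → Matrix (Fin d) (Fin d) ℝ) (a : ℝ → E d), A 0 = 1 ∧ a 0 = 0 ∧
      (∀ t ∈ Icc (0 : ℝ) 1, HasDerivWithinAt A (M t * A t) (Icc 0 1) t) ∧
      ∀ t ∈ Icc (0 : ℝ) 1, HasDerivWithinAt a (act (M t) (a t) + w t) (Icc 0 1) t := by
  obtain ⟨A, hA0, hA⟩ := exists_hasDerivWithinAt_linear zero_le_one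
    ((ContinuousLinearMap.mul ℝ _).continuous.comp_continuousOn hM) 1
  -- The inhomogeneous equation for `a` is the linear equation for the pair `(a, 1)`.
  have hL : ContinuousOn (fun t =>
      (ContinuousLinearMap.inl ℝ (E d) ℝ).comp ((actL (M t)).comp (ContinuousLinearMap.fst ℝ _ ℝ) +
        (ContinuousLinearMap.snd ℝ (E d) ℝ).smulRight (w t))) (Icc 0 1) :=
    continuousOn_const.clm_comp (((actL.continuous.comp_continuousOn hM).clm_comp
      continuousOn_const).add ((ContinuousLinearMap.smulRightL ℝ (E d × ℝ) (E d)
        (ContinuousLinearMap.snd ℝ (E d) ℝ)).continuous.comp_continuousOn hw))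
  obtain ⟨z, hz0, hz⟩ := exists_hasDerivWithinAt_linear zero_le_one hL (0, 1)
  have hz₁ : ∀ t ∈ Icc (0 : ℝ) 1, (z t).2 = 1 := fun t ht =>
    (eq_left_of_hasDerivWithinAt_zero
      (fun s hs => hasFDerivAt_snd.comp_hasDerivWithinAt s (hz s hs)) ht).trans (by simp [hz0])
  refine ⟨A, fun t => (z t).1, hA0, by simp [hz0], hA, fun t ht => ?_⟩
  refine (hasFDerivAt_fst.comp_hasDerivWithinAt t (hz t ht)).congr_deriv ?_
  simp [hz₁ t ht, actL_apply]

end Flow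

section Transport

open scoped Matrix.Norms.Operator

variable {d : ℕ} {f : E d → ℝ} {B : Matrix (Fin d) (Fin d) ℝ} {b : E d} {c lam : ℝ}
  {ρ : ℝ → E d → ℝ}

namespace IsDualGeodesic

theorem continuousOn_velMat (h : IsDualGeodesic lam f ρ) (B : Matrix (Fin d) (Fin d) ℝ) :
    ContinuousOn (fun t => velMat lam (cov (ρ t)) B) (Icc 0 1) :=
  (h.cov_continuous.add continuousOn_const).mul continuousOn_const

theorem continuousOn_velVec (h : IsDualGeodesic lam f ρ) (b : E d) :
    ContinuousOn (fun t => velVec lam (cov (ρ t)) b) (Icc 0 1) :=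
  (actL.continuous.comp_continuousOn (h.cov_continuous.add continuousOn_const)).clm_apply
    continuousOn_const

theorem hasDerivWithinAt_characteristic (hB : B.IsSymm)
    (hf : ∀ x, f x = 1 / 2 * quadForm B x + inner ℝ b x + c) (h : IsDualGeodesic lam f ρ)
    {X : ℝ → E d} {t : ℝ} (ht : t ∈ Icc (0 : ℝ) 1)
    (hX : HasDerivWithinAt X (act (velMat lam (cov (ρ t)) B) (X t) + velVec lam (cov (ρ t)) b)
      (Icc (0 : ℝ) 1) t) :
    HasDerivWithinAt (fun s => ρ s (X s)) (-(ρ t (X t) * (velMat lam (cov (ρ t)) B).trace))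
      (Icc (0 : ℝ) 1) t := by
  refine (hasDerivWithinAt_along_curve (uniqueDiffOn_Icc zero_lt_one t ht) ht
    (h.smooth.differentiableOn (by simp) (t, X t) ⟨ht, mem_univ _⟩)
    (h.geodesic t ht (X t)) hX).congr_deriv ?_
  rw [inertia_quadratic hB hf ((h.density t ht).smooth.differentiable (by simp) _)]
  ring

theorem det_mul_comp_flow (hB : B.IsSymm)
    (hf : ∀ x, f x = 1 / 2 * quadForm B x + inner ℝ b x + c) (h : IsDualGeodesic lam f ρ)
    {A : ℝ → Matrix (Fin d) (Fin d) ℝ} {a : ℝ → E d} (hA0 : A 0 = 1) (ha0 : a 0 = 0)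
    (hA : ∀ t ∈ Icc (0 : ℝ) 1, HasDerivWithinAt A (velMat lam (cov (ρ t)) B * A t) (Icc 0 1) t)
    (ha : ∀ t ∈ Icc (0 : ℝ) 1, HasDerivWithinAt a
      (act (velMat lam (cov (ρ t)) B) (a t) + velVec lam (cov (ρ t)) b) (Icc 0 1) t)
    {t : ℝ} (ht : t ∈ Icc (0 : ℝ) 1) (y : E d) :
    (A t).det * ρ t (act (A t) y + a t) = ρ 0 y := by
  have hX : ∀ s ∈ Icc (0 : ℝ) 1, HasDerivWithinAt (fun s => act (A s) y + a s)
      (act (velMat lam (cov (ρ s)) B) (act (A s) y + a s) + velVec lam (cov (ρ s)) b) (Icc 0 1) s :=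
    fun s hs => ((hasDerivWithinAt_act (hA s hs) y).add (ha s hs)).congr_deriv (by
      rw [act_mul, act_add, add_assoc])
  have hzero : ∀ s ∈ Icc (0 : ℝ) 1,
      HasDerivWithinAt (fun s => (A s).det * ρ s (act (A s) y + a s)) 0 (Icc 0 1) s :=
    fun s hs => ((hasDerivWithinAt_det (hA s hs)).mul
      (h.hasDerivWithinAt_characteristic hB hf hs (hX s hs))).congr_deriv (by ring)
  rw [eq_left_of_hasDerivWithinAt_zero hzero ht, hA0, ha0, act_one, add_zero, Matrix.det_one,
    one_mul]

theorem exists_affine_hasMoments (hB : B.IsSymm)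
    (hf : ∀ x, f x = 1 / 2 * quadForm B x + inner ℝ b x + c) (h : IsDualGeodesic lam f ρ) :
    ∃ (A : ℝ → Matrix (Fin d) (Fin d) ℝ) (a : ℝ → E d),
      (∀ t ∈ Icc (0 : ℝ) 1, 0 < (A t).det) ∧
      (∀ t ∈ Icc (0 : ℝ) 1, HasDerivWithinAt A (velMat lam (cov (ρ t)) B * A t) (Icc 0 1) t) ∧
      (∀ t ∈ Icc (0 : ℝ) 1, HasDerivWithinAt a
        (act (velMat lam (cov (ρ t)) B) (a t) + velVec lam (cov (ρ t)) b) (Icc 0 1) t) ∧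
      ∀ t ∈ Icc (0 : ℝ) 1, HasMoments (ρ t) (act (A t) (meanVec (ρ 0)) + a t)
        (A t * cov (ρ 0) * (A t)ᵀ) := by
  obtain ⟨A, a, hA0, ha0, hA, ha⟩ :=
    exists_affine_flow (h.continuousOn_velMat B) (h.continuousOn_velVec b)
  have h₀ := h.density 0 (by simp)
  have htransport := fun t (ht : t ∈ Icc (0 : ℝ) 1) y =>
    h.det_mul_comp_flow hB hf hA0 ha0 hA ha ht y
  have hdet : ∀ t ∈ Icc (0 : ℝ) 1, 0 < (A t).det := fun t ht =>
    pos_of_mul_pos_left ((htransport t ht 0).symm ▸ h₀.pos 0) ((h.density t ht).pos _).le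
  refine ⟨A, a, hdet, hA, ha, fun t ht => h₀.hasMoments.transport (hdet t ht).ne' fun y => ?_⟩
  rw [abs_of_pos (hdet t ht), htransport t ht]

theorem posDef_cov (hB : B.IsSymm) (hf : ∀ x, f x = 1 / 2 * quadForm B x + inner ℝ b x + c)
    (h : IsDualGeodesic lam f ρ) (h₀ : (cov (ρ 0)).PosDef) {t : ℝ} (ht : t ∈ Icc (0 : ℝ) 1) :
    (cov (ρ t)).PosDef := by
  obtain ⟨A, a, hdet, -, -, hM⟩ := h.exists_affine_hasMoments hB hf
  rw [(hM t ht).cov_eq, ← Matrix.conjTranspose_eq_transpose_of_trivial]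
  exact h₀.mul_mul_conjTranspose_same <| Matrix.vecMul_injective_of_isUnit <|
    (Matrix.isUnit_iff_isUnit_det _).mpr (hdet t ht).ne'.isUnit

theorem hasDerivWithinAt_cov (hB : B.IsSymm)
    (hf : ∀ x, f x = 1 / 2 * quadForm B x + inner ℝ b x + c) (h : IsDualGeodesic lam f ρ)
    {t : ℝ} (ht : t ∈ Icc (0 : ℝ) 1) :
    HasDerivWithinAt (fun s => cov (ρ s))
      (velMat lam (cov (ρ t)) B * cov (ρ t) + cov (ρ t) * (velMat lam (cov (ρ t)) B)ᵀ)
      (Icc 0 1) t := by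
  obtain ⟨A, a, -, hA, -, hM⟩ := h.exists_affine_hasMoments hB hf
  refine ((((hA t ht).mul_const (cov (ρ 0))).mul (hasDerivWithinAt_transpose (hA t ht))).congr_deriv
    ?_).congr (fun s hs => (hM s hs).cov_eq) (hM t ht).cov_eq
  rw [Matrix.transpose_mul, (hM t ht).cov_eq]
  simp only [mul_assoc]

theorem hasDerivWithinAt_meanVec (hB : B.IsSymm)
    (hf : ∀ x, f x = 1 / 2 * quadForm B x + inner ℝ b x + c) (h : IsDualGeodesic lam f ρ)
    {t : ℝ} (ht : t ∈ Icc (0 : ℝ) 1) :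
    HasDerivWithinAt (fun s => meanVec (ρ s))
      (act (velMat lam (cov (ρ t)) B) (meanVec (ρ t)) + velVec lam (cov (ρ t)) b) (Icc 0 1) t := by
  obtain ⟨A, a, -, hA, ha, hM⟩ := h.exists_affine_hasMoments hB hf
  refine ((hasDerivWithinAt_act (hA t ht) _).add (ha t ht)).congr_deriv ?_
    |>.congr (fun s hs => (hM s hs).meanVec_eq) (hM t ht).meanVec_eq
  rw [act_mul, (hM t ht).meanVec_eq, act_add, add_assoc]

end IsDualGeodesic

end Transport

/-! ### One coordinate: the equations for variance and mean -/

section Scalar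

/-- `c` solves the Riccati equation for the variance, in one coordinate, along a dual geodesic whose
potential has second derivative `β` there. -/
structure IsVarianceCurve (lam β : ℝ) (c : ℝ → ℝ) : Prop where
  pos : ∀ t ∈ Icc (0 : ℝ) 1, 0 < c t
  var : ∀ t ∈ Icc (0 : ℝ) 1, HasDerivWithinAt c (2 * β * (c t + lam) * c t) (Icc 0 1) t

/-- `c` and `n` are the variance and the mean, in one coordinate, of a dual geodesic whose potential
is `½ β x² + b x` there. -/
structure IsScalarGeodesic (lam β b : ℝ) (c n : ℝ → ℝ) : Prop
    extends IsVarianceCurve lam β c where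
  mean : ∀ t ∈ Icc (0 : ℝ) 1, HasDerivWithinAt n ((c t + lam) * (β * n t + b)) (Icc 0 1) t

variable {lam β b : ℝ} {c n : ℝ → ℝ}

theorem integral_eq_sub_of_hasDerivWithinAt {F F' : ℝ → ℝ} {a b : ℝ} (hab : a ≤ b)
    (hF' : ContinuousOn F' (Icc a b))
    (hF : ∀ t ∈ Icc a b, HasDerivWithinAt F (F' t) (Icc a b) t) :
    ∫ t in a..b, F' t = F b - F a :=
  intervalIntegral.integral_eq_sub_of_hasDerivAt_of_le hab
    (fun t ht => (hF t ht).continuousWithinAt)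
    (fun t ht => (hF t (Ioo_subset_Icc_self ht)).hasDerivAt (Icc_mem_nhds ht.1 ht.2))
    (hF'.intervalIntegrable_of_Icc hab)

namespace IsVarianceCurve

theorem continuousOn (h : IsVarianceCurve lam β c) : ContinuousOn c (Icc 0 1) :=
  fun t ht => (h.var t ht).continuousWithinAt

theorem slope_eq (h : IsVarianceCurve lam β c) (hlam : 0 < lam) :
    β = (Real.log (c 1 / c 0) + Real.log ((c 0 + lam) / (c 1 + lam))) / (2 * lam) := by
  have h₀ := h.pos 0 (by simp)
  have h₁ := h.pos 1 (by simp)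
  have hzero : ∀ t ∈ Icc (0 : ℝ) 1, HasDerivWithinAt
      (fun t => Real.log (c t) - Real.log (c t + lam) - 2 * lam * β * t) 0 (Icc 0 1) t := by
    intro t ht
    have hc := h.pos t ht
    refine ((((h.var t ht).log hc.ne').sub (((h.var t ht).add_const lam).log (by positivity))).sub
      ((hasDerivAt_id' t).hasDerivWithinAt.const_mul (2 * lam * β))).congr_deriv ?_
    field_simp
    ring
  have hconst := eq_left_of_hasDerivWithinAt_zero hzero (right_mem_Icc.mpr zero_le_one)
  rw [eq_div_iff (by positivity), Real.log_div h₁.ne' h₀.ne',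
    Real.log_div (by positivity) (by positivity)]
  linarith

theorem eq_left_of_slope_eq_zero (h : IsVarianceCurve lam 0 c) {t : ℝ} (ht : t ∈ Icc (0 : ℝ) 1) :
    c t = c 0 :=
  eq_left_of_hasDerivWithinAt_zero (fun s hs => (h.var s hs).congr_deriv (by ring)) ht

theorem left_ne_right (h : IsVarianceCurve lam β c) (hlam : 0 < lam) (hβ : β ≠ 0) : c 0 ≠ c 1 := by
  intro heq
  have h₁ := h.pos 1 (by simp)
  apply hβ
  rw [h.slope_eq hlam, heq, div_self h₁.ne', div_self (by positivity), Real.log_one, add_zero,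
    zero_div]

theorem hasDerivWithinAt_sqrt (h : IsVarianceCurve lam β c) {t : ℝ} (ht : t ∈ Icc (0 : ℝ) 1) :
    HasDerivWithinAt (fun t => √(c t)) (β * (c t + lam) * √(c t)) (Icc 0 1) t := by
  refine ((h.var t ht).sqrt (h.pos t ht).ne').congr_deriv ?_
  calc 2 * β * (c t + lam) * c t / (2 * √(c t)) = β * (c t + lam) * (c t / √(c t)) := by ring
    _ = β * (c t + lam) * √(c t) := by rw [Real.div_sqrt]

theorem integral_eq (h : IsVarianceCurve lam β c) (hlam : 0 < lam) :
    ∫ t in (0 : ℝ)..1, t * (β ^ 2 * (c t + lam) * c t) = xiScalar lam (c 0) (c 1) / (4 * lam) := by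
  have hcont := h.continuousOn
  have h₀ := h.pos 0 (by simp)
  have h₁ := h.pos 1 (by simp)
  have hprimitive : ∀ t ∈ Icc (0 : ℝ) 1, HasDerivWithinAt
      (fun t => t * (β / 2 * c t) - 1 / 4 * Real.log (c t + lam))
      (t * (β ^ 2 * (c t + lam) * c t)) (Icc 0 1) t := by
    intro t ht
    have hc := h.pos t ht
    refine (((hasDerivAt_id' t).hasDerivWithinAt.mul ((h.var t ht).const_mul (β / 2))).sub
      ((((h.var t ht).add_const lam).log (by positivity)).const_mul (1 / 4))).congr_deriv ?_
    field_simp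
    ring
  rw [integral_eq_sub_of_hasDerivWithinAt zero_le_one (by fun_prop) hprimitive]
  calc 1 * (β / 2 * c 1) - 1 / 4 * Real.log (c 1 + lam) -
        (0 * (β / 2 * c 0) - 1 / 4 * Real.log (c 0 + lam))
      = β * c 1 / 2 + 1 / 4 * Real.log ((c 0 + lam) / (c 1 + lam)) := by
        rw [Real.log_div (by positivity) (by positivity)]
        ring
    _ = xiScalar lam (c 0) (c 1) / (4 * lam) := by
        rw [h.slope_eq hlam, xiScalar]
        field_simp
        ring

end IsVarianceCurve

namespace IsScalarGeodesic

theorem continuousOn_mean (h : IsScalarGeodesic lam β b c n) : ContinuousOn n (Icc 0 1) :=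
  fun t ht => (h.mean t ht).continuousWithinAt

theorem mean_sub_of_slope_eq_zero (h : IsScalarGeodesic lam 0 b c n) :
    n 1 - n 0 = (c 0 + lam) * b := by
  have hzero : ∀ t ∈ Icc (0 : ℝ) 1, HasDerivWithinAt (fun t => n t - (c 0 + lam) * b * t) 0
      (Icc 0 1) t := by
    intro t ht
    refine ((h.mean t ht).sub ((hasDerivAt_id' t).hasDerivWithinAt.const_mul _)).congr_deriv ?_
    rw [h.eq_left_of_slope_eq_zero ht]
    ring
  linarith [eq_left_of_hasDerivWithinAt_zero hzero (right_mem_Icc.mpr zero_le_one)]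

theorem integral_mean_of_slope_eq_zero (h : IsScalarGeodesic lam 0 b c n) (hlam : 0 < lam) :
    ∫ t in (0 : ℝ)..1, t * ((c t + lam) * (0 * n t + b) ^ 2) =
      (n 1 - n 0) ^ 2 / (2 * (c 0 + lam)) := by
  have h₀ := h.pos 0 (by simp)
  calc ∫ t in (0 : ℝ)..1, t * ((c t + lam) * (0 * n t + b) ^ 2)
      = ∫ t in (0 : ℝ)..1, t * ((c 0 + lam) * b ^ 2) := by
        refine intervalIntegral.integral_congr fun t ht => ?_
        rw [uIcc_of_le zero_le_one] at ht
        simp only [h.eq_left_of_slope_eq_zero ht, zero_mul, zero_add]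
    _ = (n 1 - n 0) ^ 2 / (2 * (c 0 + lam)) := by
        rw [intervalIntegral.integral_mul_const, integral_id, h.mean_sub_of_slope_eq_zero]
        field_simp
        ring

theorem exists_gradient_eq_mul_sqrt (h : IsScalarGeodesic lam β b c n) :
    ∃ k, ∀ t ∈ Icc (0 : ℝ) 1, β * n t + b = k * √(c t) := by
  have hsqrt : ∀ t ∈ Icc (0 : ℝ) 1, √(c t) ≠ 0 := fun t ht => (Real.sqrt_pos.mpr (h.pos t ht)).ne'
  have hzero : ∀ t ∈ Icc (0 : ℝ) 1,
      HasDerivWithinAt (fun t => (β * n t + b) / √(c t)) 0 (Icc 0 1) t := by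
    intro t ht
    refine ((((h.mean t ht).const_mul β).add_const b).div (h.hasDerivWithinAt_sqrt ht)
      (hsqrt t ht)).congr_deriv ?_
    ring
  refine ⟨(β * n 0 + b) / √(c 0), fun t ht => ?_⟩
  rw [← eq_left_of_hasDerivWithinAt_zero hzero ht, div_mul_cancel₀ _ (hsqrt t ht)]

theorem integral_mean_of_slope_ne_zero (h : IsScalarGeodesic lam β b c n) (hlam : 0 < lam)
    (hβ : β ≠ 0) :
    ∫ t in (0 : ℝ)..1, t * ((c t + lam) * (β * n t + b) ^ 2) =
      xiScalar lam (c 0) (c 1) / (4 * lam) * (n 1 - n 0) ^ 2 / (√(c 1) - √(c 0)) ^ 2 := by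
  obtain ⟨k, hk⟩ := h.exists_gradient_eq_mul_sqrt
  have hsub : √(c 1) - √(c 0) ≠ 0 := by
    rw [sub_ne_zero, Ne, Real.sqrt_inj (h.pos 1 (by simp)).le (h.pos 0 (by simp)).le]
    exact (h.left_ne_right hlam hβ).symm
  have hmean : n 1 - n 0 = k / β * (√(c 1) - √(c 0)) := by
    field_simp
    linear_combination hk 1 (by simp) - hk 0 (by simp)
  calc ∫ t in (0 : ℝ)..1, t * ((c t + lam) * (β * n t + b) ^ 2)
      = ∫ t in (0 : ℝ)..1, (k / β) ^ 2 * (t * (β ^ 2 * (c t + lam) * c t)) := by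
        refine intervalIntegral.integral_congr fun t ht => ?_
        rw [uIcc_of_le zero_le_one] at ht
        simp only [hk t ht, mul_pow, Real.sq_sqrt (h.pos t ht).le]
        field_simp
    _ = xiScalar lam (c 0) (c 1) / (4 * lam) * (n 1 - n 0) ^ 2 / (√(c 1) - √(c 0)) ^ 2 := by
        rw [intervalIntegral.integral_const_mul, h.integral_eq hlam, hmean]
        field_simp

theorem integral_eq_coordValue (h : IsScalarGeodesic lam β b c n) (hlam : 0 < lam) :
    ∫ t in (0 : ℝ)..1, t * (β ^ 2 * (c t + lam) * c t + (c t + lam) * (β * n t + b) ^ 2) =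
      coordValue lam (c 0) (c 1) (n 1 - n 0) := by
  have hc := h.continuousOn
  have hn := h.continuousOn_mean
  have hint : ∀ F : ℝ → ℝ, ContinuousOn F (Icc 0 1) → IntervalIntegrable F volume 0 1 :=
    fun F hF => hF.intervalIntegrable_of_Icc zero_le_one
  simp only [mul_add (_ : ℝ) (β ^ 2 * _ * _)]
  rw [intervalIntegral.integral_add (hint _ (by fun_prop)) (hint _ (by fun_prop)),
    h.integral_eq hlam, coordValue]
  congr 1
  rcases eq_or_ne β 0 with rfl | hβ
  · rw [if_pos (h.eq_left_of_slope_eq_zero (by simp)).symm, h.integral_mean_of_slope_eq_zero hlam]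
  · rw [if_neg (h.left_ne_right hlam hβ), h.integral_mean_of_slope_ne_zero hlam hβ]

end IsScalarGeodesic

end Scalar

/-! ### Dual geodesics decouple into their coordinates -/

section Riccati

open scoped Matrix.Norms.Operator

theorem exp_smul_mul_mul_exp_smul_eq {A : Type*} [NormedRing A] [NormedAlgebra ℝ A]
    [CompleteSpace A] {B : A} {Z : ℝ → A} {T : ℝ}
    (hZ : ∀ t ∈ Icc 0 T, HasDerivWithinAt Z (-(B * Z t + Z t * B)) (Icc 0 T) t) {t : ℝ}
    (ht : t ∈ Icc 0 T) :
    NormedSpace.exp (t • B) * Z t * NormedSpace.exp (t • B) = Z 0 := by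
  have hzero : ∀ s ∈ Icc 0 T, HasDerivWithinAt
      (fun s => NormedSpace.exp (s • B) * Z s * NormedSpace.exp (s • B)) 0 (Icc 0 T) s := by
    intro s hs
    refine (((hasDerivAt_exp_smul_const (𝕂 := ℝ) B s).hasDerivWithinAt.mul (hZ s hs)).mul
      (hasDerivAt_exp_smul_const' (𝕂 := ℝ) B s).hasDerivWithinAt).congr_deriv ?_
    simp only [Pi.mul_apply]
    noncomm_ring
  simpa using eq_left_of_hasDerivWithinAt_zero hzero ht

theorem hasDerivWithinAt_one_add_smul_inv {d : ℕ} {C : ℝ → Matrix (Fin d) (Fin d) ℝ}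
    {B : Matrix (Fin d) (Fin d) ℝ} {lam t : ℝ} {I : Set ℝ} (hB : B.IsSymm) (ht : (C t).PosDef)
    (hC : HasDerivWithinAt C (velMat lam (C t) B * C t + C t * (velMat lam (C t) B)ᵀ) I t) :
    HasDerivWithinAt (fun s => 1 + lam • (C s)⁻¹)
      (-(lam • B * (1 + lam • (C t)⁻¹) + (1 + lam • (C t)⁻¹) * lam • B)) I t := by
  refine (((hasDerivWithinAt_matrix_inv hC ht.isUnit).const_smul lam).const_add 1).congr_deriv ?_
  have hdet := (Matrix.isUnit_iff_isUnit_det _).mp ht.isUnit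
  have hsymm : (C t)ᵀ = C t := by
    rw [← Matrix.conjTranspose_eq_transpose_of_trivial, ht.isHermitian.eq]
  have hleft : (C t)⁻¹ * (velMat lam (C t) B * C t) * (C t)⁻¹ = (1 + lam • (C t)⁻¹) * B := by
    rw [velMat, mul_assoc, Matrix.mul_nonsing_inv_cancel_right _ _ hdet, ← mul_assoc, mul_add,
      Matrix.nonsing_inv_mul _ hdet, mul_smul_comm, mul_one]
  have hright : (C t)⁻¹ * (C t * (velMat lam (C t) B)ᵀ) * (C t)⁻¹ = B * (1 + lam • (C t)⁻¹) := by
    rw [velMat, Matrix.nonsing_inv_mul_cancel_left _ _ hdet, Matrix.transpose_mul, hB.eq,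
      Matrix.transpose_add, hsymm, Matrix.transpose_smul, Matrix.transpose_one, mul_assoc, add_mul,
      Matrix.mul_nonsing_inv _ hdet, smul_mul_assoc, one_mul]
  rw [mul_add, add_mul, hleft, hright, smul_mul_assoc, mul_smul_comm, smul_neg, smul_add, add_comm]

variable {n : Type*} [Fintype n] [DecidableEq n] (U : Matrix.unitaryGroup n ℝ)

theorem eq_odiag_of_odiag_mul_mul_eq {e z : n → ℝ} (he : ∀ i, e i ≠ 0) {X : Matrix n n ℝ}
    (h : odiag U e * X * odiag U e = odiag U z) : X = odiag U (e⁻¹ * z * e⁻¹) := by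
  have hee : e⁻¹ * e = 1 := funext fun i => inv_mul_cancel₀ (he i)
  calc X = odiag U (e⁻¹ * e) * X * odiag U (e * e⁻¹) := by
        rw [mul_comm e, hee, map_one, one_mul, mul_one]
    _ = odiag U e⁻¹ * (odiag U e * X * odiag U e) * odiag U e⁻¹ := by
        simp only [map_mul, mul_assoc]
    _ = odiag U (e⁻¹ * z * e⁻¹) := by rw [h, map_mul, map_mul]

theorem eq_odiag_of_mul_self_eq {X : Matrix n n ℝ} (hX : X.PosDef) {w : n → ℝ}
    (h : X * X = odiag U w) : X = odiag U (Real.sqrt ∘ w) := by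
  rw [← cfc_odiag, ← h]
  obtain ⟨V, a, rfl⟩ := exists_eq_odiag hX.isHermitian
  rw [← map_mul, cfc_odiag]
  exact congrArg _ (funext fun i => (Real.sqrt_mul_self ((odiag_posDef_iff V).mp hX i).le).symm)

theorem exists_eq_odiag_of_exp_eq {B : Matrix n n ℝ} (hB : B.IsHermitian) {w : n → ℝ}
    (h : NormedSpace.exp B = odiag U w) : ∃ β, B = odiag U β := by
  refine ⟨Real.log ∘ w, ?_⟩
  rw [← cfc_odiag, ← h]
  obtain ⟨V, a, rfl⟩ := exists_eq_odiag hB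
  rw [exp_odiag, cfc_odiag]
  exact congrArg _ (funext fun i => (Real.log_exp (a i)).symm)

theorem posDef_exp {B : Matrix n n ℝ} (hB : B.IsHermitian) :
    (NormedSpace.exp B).PosDef := by
  obtain ⟨V, a, rfl⟩ := exists_eq_odiag hB
  rw [exp_odiag, odiag_posDef_iff]
  exact fun i => Real.exp_pos (a i)

theorem exists_eq_odiag_of_mul_mul_eq {G : Matrix n n ℝ} (hG : G.PosDef) {z₀ z₁ : n → ℝ}
    (hz₁ : ∀ i, 0 < z₁ i) (h : G * odiag U z₁ * G = odiag U z₀) : ∃ γ, G = odiag U γ := by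
  set s : n → ℝ := Real.sqrt ∘ z₁
  have hs : ∀ i, 0 < s i := fun i => Real.sqrt_pos.mpr (hz₁ i)
  have hss : odiag U s * odiag U s = odiag U z₁ := by
    rw [← map_mul]
    exact congrArg _ (funext fun i => Real.mul_self_sqrt (hz₁ i).le)
  -- Conjugation by the root of `z₁` turns the equation into one for a positive definite square.
  have hpos : (odiag U s * G * odiag U s).PosDef := by
    have hconj := hG.mul_mul_conjTranspose_same (B := odiag U s)
      (Matrix.vecMul_injective_of_isUnit ((odiag_posDef_iff U).mpr hs).isUnit)
    rwa [(odiag_isHermitian U s).eq] at hconj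
  have hsq : (odiag U s * G * odiag U s) * (odiag U s * G * odiag U s) = odiag U (s * z₀ * s) := by
    rw [map_mul, map_mul, ← h, ← hss]
    simp only [mul_assoc]
  exact ⟨_, eq_odiag_of_odiag_mul_mul_eq U (fun i => (hs i).ne')
    (eq_odiag_of_mul_self_eq U hpos hsq)⟩

end Riccati

section Decoupling

open scoped Matrix.Norms.Operator

variable {d : ℕ} (U : Matrix.unitaryGroup (Fin d) ℝ)

theorem one_add_smul_inv_odiag (lam : ℝ) {v : Fin d → ℝ} (hv : ∀ i, 0 < v i) :
    1 + lam • (odiag U v)⁻¹ = odiag U (1 + lam • v⁻¹) := by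
  rw [odiag_inv U fun i => (hv i).ne', map_add, map_one, map_smul]

theorem exists_eq_odiag_of_one_add_smul_inv_eq {C : Matrix (Fin d) (Fin d) ℝ} (hC : C.PosDef)
    {lam : ℝ} (hlam : lam ≠ 0) {z : Fin d → ℝ} (h : 1 + lam • C⁻¹ = odiag U z) :
    ∃ c, C = odiag U c := by
  have hinv : C⁻¹ = odiag U (lam⁻¹ • (z - 1)) := by
    rw [map_smul, map_sub, map_one, ← h, add_sub_cancel_left, smul_smul, inv_mul_cancel₀ hlam,
      one_smul]
  have hpos := (odiag_posDef_iff U).mp (hinv ▸ hC.inv)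
  refine ⟨(lam⁻¹ • (z - 1))⁻¹, ?_⟩
  rw [← odiag_inv U fun i => (hpos i).ne', ← hinv,
    Matrix.nonsing_inv_nonsing_inv _ ((Matrix.isUnit_iff_isUnit_det _).mp hC.isUnit)]

theorem exists_odiag_of_riccati {C : ℝ → Matrix (Fin d) (Fin d) ℝ} {B : Matrix (Fin d) (Fin d) ℝ}
    {lam : ℝ} (hlam : 0 < lam) (hB : B.IsSymm) (hpos : ∀ t ∈ Icc (0 : ℝ) 1, (C t).PosDef)
    (hC : ∀ t ∈ Icc (0 : ℝ) 1, HasDerivWithinAt C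
      (velMat lam (C t) B * C t + C t * (velMat lam (C t) B)ᵀ) (Icc 0 1) t)
    {p q : Fin d → ℝ} (h₀ : C 0 = odiag U p) (h₁ : C 1 = odiag U q) :
    ∃ (β : Fin d → ℝ) (c : ℝ → Fin d → ℝ), B = odiag U β ∧
      ∀ t ∈ Icc (0 : ℝ) 1, C t = odiag U (c t) := by
  have hp := (odiag_posDef_iff U).mp (h₀ ▸ hpos 0 (by simp))
  have hq := (odiag_posDef_iff U).mp (h₁ ▸ hpos 1 (by simp))
  have hB' : (lam • B).IsHermitian := by
    rw [Matrix.IsHermitian, Matrix.conjTranspose_eq_transpose_of_trivial, Matrix.transpose_smul,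
      hB.eq]
  have hconst : ∀ t ∈ Icc (0 : ℝ) 1, NormedSpace.exp (t • lam • B) * (1 + lam • (C t)⁻¹) *
      NormedSpace.exp (t • lam • B) = odiag U (1 + lam • p⁻¹) := fun t ht => by
    rw [← one_add_smul_inv_odiag U lam hp, ← h₀]
    exact exp_smul_mul_mul_exp_smul_eq (Z := fun t => 1 + lam • (C t)⁻¹)
      (fun s hs => hasDerivWithinAt_one_add_smul_inv hB (hpos s hs) (hC s hs)) ht
  obtain ⟨β, hβ⟩ : ∃ β, lam • B = odiag U β := by
    have hend := hconst 1 (by simp)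
    rw [one_smul, h₁, one_add_smul_inv_odiag U lam hq] at hend
    have hz : ∀ i, 0 < (1 + lam • q⁻¹) i := fun i =>
      add_pos one_pos (mul_pos hlam (inv_pos.mpr (hq i)))
    obtain ⟨γ, hγ⟩ := exists_eq_odiag_of_mul_mul_eq U (posDef_exp hB') hz hend
    exact exists_eq_odiag_of_exp_eq U hB' hγ
  have hdiag : ∀ t ∈ Icc (0 : ℝ) 1, ∃ c, C t = odiag U c := fun t ht => by
    have hexp := hconst t ht
    rw [hβ, ← map_smul, exp_odiag] at hexp
    exact exists_eq_odiag_of_one_add_smul_inv_eq U (hpos t ht) hlam.ne'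
      (eq_odiag_of_odiag_mul_mul_eq U (fun i => (Real.exp_pos _).ne') hexp)
  choose! c hc using hdiag
  refine ⟨lam⁻¹ • β, c, ?_, hc⟩
  rw [map_smul, ← hβ, smul_smul, inv_mul_cancel₀ hlam.ne', one_smul]

/-- The diagonal of `Uᵀ X U`, that is, the coefficients of the matrix `X` in the basis of the
columns of `U`. -/
def odiagCoeff : Matrix (Fin d) (Fin d) ℝ →ₗ[ℝ] Fin d → ℝ :=
  Matrix.diagLinearMap (Fin d) ℝ ℝ ∘ₗ LinearMap.mulLeft ℝ U.1ᵀ ∘ₗ LinearMap.mulRight ℝ U.1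

theorem odiagCoeff_odiag (a : Fin d → ℝ) : odiagCoeff U (odiag U a) = a := by
  have hconj : U.1ᵀ * (odiag U a * U.1) = Matrix.diagonal a :=
    calc U.1ᵀ * (odiag U a * U.1) = (U.1ᵀ * U.1) * Matrix.diagonal a * (U.1ᵀ * U.1) := by
          simp only [odiag_apply, mul_assoc]
      _ = Matrix.diagonal a := by rw [transpose_mul_coe, one_mul, mul_one]
  exact (congrArg Matrix.diag hconj).trans (Matrix.diag_diagonal a)

theorem act_transpose_act_odiag (a : Fin d → ℝ) (x : E d) (i : Fin d) :
    act U.1ᵀ (act (odiag U a) x) i = a i * act U.1ᵀ x i := by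
  rw [← act_mul, odiag_apply, ← mul_assoc, ← mul_assoc, transpose_mul_coe, one_mul, act_mul]
  exact Matrix.mulVec_diagonal a (act U.1ᵀ x).ofLp i

theorem odiag_add_smul_one (lam : ℝ) (c : Fin d → ℝ) :
    odiag U c + lam • 1 = odiag U (c + lam • 1) := by
  rw [map_add, map_smul, map_one]

theorem velMat_odiag (lam : ℝ) (c β : Fin d → ℝ) :
    velMat lam (odiag U c) (odiag U β) = odiag U ((c + lam • 1) * β) := by
  rw [velMat, odiag_add_smul_one, map_mul]

namespace IsDualGeodesic

variable {U} {f : E d → ℝ} {b : E d} {c₀ lam : ℝ} {ρ : ℝ → E d → ℝ}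

theorem exists_odiag {B : Matrix (Fin d) (Fin d) ℝ} (hB : B.IsSymm)
    (hf : ∀ x, f x = 1 / 2 * quadForm B x + inner ℝ b x + c₀) (h : IsDualGeodesic lam f ρ)
    (hlam : 0 < lam) {p q : Fin d → ℝ} (hp : ∀ i, 0 < p i) (h₀ : cov (ρ 0) = odiag U p)
    (h₁ : cov (ρ 1) = odiag U q) :
    ∃ (β : Fin d → ℝ) (c : ℝ → Fin d → ℝ), B = odiag U β ∧
      ∀ t ∈ Icc (0 : ℝ) 1, cov (ρ t) = odiag U (c t) :=
  exists_odiag_of_riccati U hlam hB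
    (fun _ ht => h.posDef_cov hB hf (h₀ ▸ (odiag_posDef_iff U).mpr hp) ht)
    (fun _ ht => h.hasDerivWithinAt_cov hB hf ht) h₀ h₁

theorem isScalarGeodesic {β : Fin d → ℝ} {c : ℝ → Fin d → ℝ}
    (hf : ∀ x, f x = 1 / 2 * quadForm (odiag U β) x + inner ℝ b x + c₀)
    (h : IsDualGeodesic lam f ρ) (hc : ∀ t ∈ Icc (0 : ℝ) 1, cov (ρ t) = odiag U (c t))
    (h₀ : ∀ i, 0 < c 0 i) (i : Fin d) :
    IsScalarGeodesic lam (β i) (act U.1ᵀ b i) (fun t => c t i)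
      (fun t => act U.1ᵀ (meanVec (ρ t)) i) where
  pos t ht := by
    have hpos := h.posDef_cov (odiag_transpose U β) hf
      (hc 0 (by simp) ▸ (odiag_posDef_iff U).mpr h₀) ht
    exact (odiag_posDef_iff U).mp (hc t ht ▸ hpos) i
  var t ht := by
    have hcov := (LinearMap.toContinuousLinearMap
      (LinearMap.proj i ∘ₗ odiagCoeff U)).hasFDerivAt.comp_hasDerivWithinAt t
        (h.hasDerivWithinAt_cov (odiag_transpose U β) hf ht)
    rw [hc t ht, velMat_odiag, odiag_transpose, ← map_mul, ← map_mul, ← map_add] at hcov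
    refine hcov.congr_deriv ?_ |>.congr (fun s hs => ?_) ?_
    · change odiagCoeff U (odiag U _) i = _
      simp only [odiagCoeff_odiag, Pi.add_apply, Pi.mul_apply, Pi.smul_apply, Pi.one_apply,
        smul_eq_mul]
      ring
    · simp [hc s hs, odiagCoeff_odiag]
    · simp [hc t ht, odiagCoeff_odiag]
  mean t ht := by
    have hmean := ((EuclideanSpace.proj i : E d →L[ℝ] ℝ).comp
      (actL U.1ᵀ)).hasFDerivAt.comp_hasDerivWithinAt t
        (h.hasDerivWithinAt_meanVec (odiag_transpose U β) hf ht)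
    refine hmean.congr_deriv ?_
    rw [hc t ht, velMat, velVec, act_mul, ← act_add, odiag_add_smul_one]
    change act U.1ᵀ (act (odiag U _) (act (odiag U β) (meanVec (ρ t)) + b)) i = _
    rw [act_transpose_act_odiag, act_add, PiLp.add_apply, act_transpose_act_odiag, Pi.add_apply,
      Pi.smul_apply, Pi.one_apply, smul_eq_mul, mul_one]

end IsDualGeodesic

end Decoupling

/-! ### The action of a dual geodesic -/

section Action

variable {d : ℕ} (U : Matrix.unitaryGroup (Fin d) ℝ) {f : E d → ℝ} {lam : ℝ}

theorem metricSq_odiag {b : E d} {c₀ : ℝ} {ρ : E d → ℝ} {m : E d} {β c : Fin d → ℝ}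
    (hf : ∀ x, f x = 1 / 2 * quadForm (odiag U β) x + inner ℝ b x + c₀) (hρ : ∀ x, 0 ≤ ρ x)
    (h : HasMoments ρ m (odiag U c)) (hc : ∀ i, 0 ≤ c i + lam) :
    metricSq lam ρ f = ENNReal.ofReal (∑ i, (β i ^ 2 * (c i + lam) * c i +
      (c i + lam) * (β i * act U.1ᵀ m i + act U.1ᵀ b i) ^ 2)) := by
  have hintegrand : ∀ x, inner ℝ (gradient f x) (ρ x • velocity lam ρ f x) =
      quadForm (odiag U (c + lam • 1)) (act (odiag U β) x + b) * ρ x := fun x => by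
    rw [velocity, gradient_quadratic (odiag_transpose U β) hf, real_inner_smul_right, h.cov_eq,
      odiag_add_smul_one, quadForm_eq_inner, mul_comm]
  have hnonneg : ∀ x, 0 ≤ quadForm (odiag U (c + lam • 1)) (act (odiag U β) x + b) * ρ x :=
    fun x => by
      rw [quadForm_odiag]
      refine mul_nonneg (Finset.sum_nonneg fun i _ => mul_nonneg ?_ (sq_nonneg _)) (hρ x)
      simpa using hc i
  rw [metricSq, lintegral_congr fun x => congrArg ENNReal.ofReal (hintegrand x),
    ← ofReal_integral_eq_lintegral_ofReal (h.integrable_quadForm_affine _ _ _)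
      (.of_forall hnonneg), h.integral_quadForm_affine, odiag_transpose, odiag_transpose,
    ← map_mul, ← map_mul, ← map_mul, odiag_trace, quadForm_odiag, ← Finset.sum_add_distrib]
  refine congrArg _ (Finset.sum_congr rfl fun i _ => ?_)
  rw [act_add, PiLp.add_apply, act_transpose_act_odiag]
  simp only [Pi.mul_apply, Pi.add_apply, Pi.smul_apply, Pi.one_apply, smul_eq_mul, mul_one]
  ring

theorem setLIntegral_Icc_ofReal_sum {ι : Type*} [Fintype ι] {F : ι → ℝ → ℝ}
    (hF : ∀ i, ContinuousOn (F i) (Icc 0 1)) (hF₀ : ∀ i, ∀ t ∈ Icc (0 : ℝ) 1, 0 ≤ F i t) :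
    ∫⁻ t in Icc (0 : ℝ) 1, ENNReal.ofReal (∑ i, F i t) =
      ENNReal.ofReal (∑ i, ∫ t in (0 : ℝ)..1, F i t) := by
  have hint : ∀ i, IntervalIntegrable (F i) volume 0 1 := fun i =>
    (hF i).intervalIntegrable_of_Icc zero_le_one
  rw [← intervalIntegral.integral_finsetSum fun i _ => hint i,
    intervalIntegral.integral_of_le zero_le_one, ← integral_Icc_eq_integral_Ioc]
  exact (ofReal_integral_eq_lintegral_ofReal
    (continuousOn_finsetSum _ fun i _ => hF i).integrableOn_Icc <|
    (ae_restrict_iff' measurableSet_Icc).mpr <| .of_forall fun t ht =>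
      Finset.sum_nonneg fun i _ => hF₀ i t ht).symm

theorem IsDualGeodesic.action_eq {ρ : ℝ → E d → ℝ} {p q : Fin d → ℝ} {m₀ m₁ : E d}
    (hf : IsQuadratic f) (h : IsDualGeodesic lam f ρ) (hlam : 0 < lam) (hp : ∀ i, 0 < p i)
    (h₀ : HasMoments (ρ 0) m₀ (odiag U p)) (h₁ : HasMoments (ρ 1) m₁ (odiag U q)) :
    action lam f ρ =
      ENNReal.ofReal (∑ i, coordValue lam (p i) (q i) (act U.1ᵀ (m₁ - m₀) i)) := by
  obtain ⟨B, b, c₀, hB, hf⟩ := hf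
  obtain ⟨β, c, rfl, hc⟩ := h.exists_odiag hB hf hlam hp h₀.cov_eq h₁.cov_eq
  obtain rfl : c 0 = p := odiag_injective U ((hc 0 (by simp)).symm.trans h₀.cov_eq)
  obtain rfl : c 1 = q := odiag_injective U ((hc 1 (by simp)).symm.trans h₁.cov_eq)
  have hs := h.isScalarGeodesic hf hc hp
  set F : Fin d → ℝ → ℝ := fun i t => t * (β i ^ 2 * (c t i + lam) * c t i +
    (c t i + lam) * (β i * act U.1ᵀ (meanVec (ρ t)) i + act U.1ᵀ b i) ^ 2)
  have hcont : ∀ i, ContinuousOn (F i) (Icc 0 1) := fun i => by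
    have hvar := (hs i).continuousOn
    have hmean := (hs i).continuousOn_mean
    fun_prop
  have hnonneg : ∀ i, ∀ t ∈ Icc (0 : ℝ) 1, 0 ≤ F i t := fun i t ht => by
    have hpos := (hs i).pos t ht
    have ht₀ := ht.1
    positivity
  have hintegrand : ∀ t ∈ Icc (0 : ℝ) 1,
      ENNReal.ofReal t * metricSq lam (ρ t) f = ENNReal.ofReal (∑ i, F i t) := fun t ht => by
    have hρ := h.density t ht
    rw [metricSq_odiag U hf (fun x => (hρ.pos x).le) (hc t ht ▸ hρ.hasMoments)
      fun i => (add_pos ((hs i).pos t ht) hlam).le, ← ENNReal.ofReal_mul ht.1, Finset.mul_sum]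
  rw [action, setLIntegral_congr_fun measurableSet_Icc hintegrand,
    setLIntegral_Icc_ofReal_sum hcont hnonneg]
  refine congrArg _ (Finset.sum_congr rfl fun i _ => ?_)
  rw [(hs i).integral_eq_coordValue hlam, h₀.meanVec_eq, h₁.meanVec_eq, act_sub]
  rfl

end Action

/-! ### Existence of dual geodesics -/

section ScalarExistence

variable {lam p q : ℝ}

/-- A logarithmic interpolation of the numbers `1 + λ / p` and `1 + λ / q`: for a variance curve
`c` from `p` to `q` the function `log (1 + λ / c t)` is affine in `t`. -/
def logRatio (lam p q t : ℝ) : ℝ :=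
  (1 - t) * Real.log (1 + lam / p) + t * Real.log (1 + lam / q)

/-- The variance curve from `p` to `q`. -/
def varCurve (lam p q t : ℝ) : ℝ :=
  lam / (Real.exp (logRatio lam p q t) - 1)

/-- The slope of the variance curve from `p` to `q`. -/
def varSlope (lam p q : ℝ) : ℝ :=
  (Real.log (1 + lam / p) - Real.log (1 + lam / q)) / (2 * lam)

theorem lam_div_exp_log_sub_one (hlam : 0 < lam) (hp : 0 < p) :
    lam / (Real.exp (Real.log (1 + lam / p)) - 1) = p := by
  rw [Real.exp_log (by positivity), add_sub_cancel_left, div_div_cancel₀ hlam.ne']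

theorem varCurve_zero (hlam : 0 < lam) (hp : 0 < p) : varCurve lam p q 0 = p := by
  simpa [varCurve, logRatio] using lam_div_exp_log_sub_one hlam hp

theorem varCurve_one (hlam : 0 < lam) (hq : 0 < q) : varCurve lam p q 1 = q := by
  simpa [varCurve, logRatio] using lam_div_exp_log_sub_one hlam hq

theorem logRatio_pos (hlam : 0 < lam) (hp : 0 < p) (hq : 0 < q) {t : ℝ}
    (ht : t ∈ Icc (0 : ℝ) 1) : 0 < logRatio lam p q t := by
  have hlog : ∀ {r : ℝ}, 0 < r → Real.log (1 + lam / r) ∈ Ioi (0 : ℝ) := fun hr =>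
    Real.log_pos (by linarith [div_pos hlam hr])
  exact convex_Ioi (0 : ℝ) (hlog hp) (hlog hq) (sub_nonneg.mpr ht.2) ht.1 (sub_add_cancel 1 t)

theorem exp_logRatio_sub_one_pos (hlam : 0 < lam) (hp : 0 < p) (hq : 0 < q) {t : ℝ}
    (ht : t ∈ Icc (0 : ℝ) 1) : 0 < Real.exp (logRatio lam p q t) - 1 :=
  sub_pos.mpr (Real.one_lt_exp_iff.mpr (logRatio_pos hlam hp hq ht))

theorem hasDerivAt_logRatio (hlam : 0 < lam) (t : ℝ) :
    HasDerivAt (logRatio lam p q) (-(2 * lam * varSlope lam p q)) t := by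
  refine ((((hasDerivAt_id' t).const_sub 1).mul_const _).add
    ((hasDerivAt_id' t).mul_const _)).congr_deriv ?_
  rw [varSlope, mul_div_cancel₀ _ (by positivity)]
  ring

theorem isVarianceCurve_varCurve (hlam : 0 < lam) (hp : 0 < p) (hq : 0 < q) :
    IsVarianceCurve lam (varSlope lam p q) (varCurve lam p q) where
  pos t ht := div_pos hlam (exp_logRatio_sub_one_pos hlam hp hq ht)
  var t ht := by
    have hne := (exp_logRatio_sub_one_pos hlam hp hq ht).ne'
    have hderiv := (hasDerivAt_const t lam).div ((hasDerivAt_logRatio hlam t).exp.sub_const 1) hne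
    refine hderiv.hasDerivWithinAt.congr_deriv ?_
    rw [varCurve]
    field_simp
    ring

theorem contDiffOn_varCurve (hlam : 0 < lam) (hp : 0 < p) (hq : 0 < q) :
    ContDiffOn ℝ ∞ (varCurve lam p q) (Icc 0 1) := by
  have hexp : ContDiff ℝ ∞ fun t => Real.exp (logRatio lam p q t) - 1 := by
    unfold logRatio
    fun_prop
  exact contDiffOn_const.div hexp.contDiffOn fun t ht =>
    (exp_logRatio_sub_one_pos hlam hp hq ht).ne'

theorem varSlope_self : varSlope lam p p = 0 := by
  rw [varSlope, sub_self, zero_div]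

theorem IsVarianceCurve.isScalarGeodesic_of_slope_eq_zero {c : ℝ → ℝ}
    (h : IsVarianceCurve lam 0 c) (hlam : 0 < lam) (n₀ v : ℝ) :
    IsScalarGeodesic lam 0 (v / (c 0 + lam)) c fun t => n₀ + v * t where
  toIsVarianceCurve := h
  mean t ht := by
    have hne : c 0 + lam ≠ 0 := (add_pos (h.pos 0 (by simp)) hlam).ne'
    refine (((hasDerivAt_id' t).const_mul v).const_add n₀).hasDerivWithinAt.congr_deriv ?_
    rw [h.eq_left_of_slope_eq_zero ht, zero_mul, zero_add, mul_div_cancel₀ _ hne, mul_one]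

theorem IsVarianceCurve.isScalarGeodesic_add_mul_sqrt {β : ℝ} {c : ℝ → ℝ}
    (h : IsVarianceCurve lam β c) (r k : ℝ) :
    IsScalarGeodesic lam β (-(β * r)) c fun t => r + k * √(c t) where
  toIsVarianceCurve := h
  mean t ht := by
    refine (((h.hasDerivWithinAt_sqrt ht).const_mul k).const_add r).congr_deriv ?_
    ring

theorem exists_isScalarGeodesic (hlam : 0 < lam) (hp : 0 < p) (hq : 0 < q) (n₀ n₁ : ℝ) :
    ∃ (β b : ℝ) (c n : ℝ → ℝ), IsScalarGeodesic lam β b c n ∧ ContDiffOn ℝ ∞ c (Icc 0 1) ∧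
      ContDiffOn ℝ ∞ n (Icc 0 1) ∧ c 0 = p ∧ c 1 = q ∧ n 0 = n₀ ∧ n 1 = n₁ := by
  have hc := isVarianceCurve_varCurve hlam hp hq
  have hsmooth := contDiffOn_varCurve hlam hp hq
  have hc₀ := varCurve_zero (q := q) hlam hp
  have hc₁ := varCurve_one (p := p) hlam hq
  rcases eq_or_ne p q with rfl | hpq
  · rw [varSlope_self] at hc
    exact ⟨_, _, _, _, hc.isScalarGeodesic_of_slope_eq_zero hlam n₀ (n₁ - n₀), hsmooth,
      by fun_prop, hc₀, hc₁, by ring, by ring⟩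
  · have hsqrt : √q - √p ≠ 0 := by
      rw [sub_ne_zero, Ne, Real.sqrt_inj hq.le hp.le]
      exact hpq.symm
    refine ⟨_, _, _, _, hc.isScalarGeodesic_add_mul_sqrt
      (n₀ - (n₁ - n₀) / (√q - √p) * √p) ((n₁ - n₀) / (√q - √p)), hsmooth,
      contDiffOn_const.add (contDiffOn_const.mul (hsmooth.sqrt fun t ht => (hc.pos t ht).ne')),
      hc₀, hc₁, ?_, ?_⟩
    · rw [hc₀, sub_add_cancel]
    · rw [hc₁]
      field_simp
      ring

theorem coordValue_nonneg (hlam : 0 < lam) (hp : 0 < p) (hq : 0 < q) (x : ℝ) :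
    0 ≤ coordValue lam p q x := by
  obtain ⟨β, b, c, n, h, -, -, rfl, rfl, hn₀, hn₁⟩ := exists_isScalarGeodesic hlam hp hq 0 x
  have hx : n 1 - n 0 = x := by rw [hn₀, hn₁, sub_zero]
  rw [← hx, ← h.integral_eq_coordValue hlam]
  refine intervalIntegral.integral_nonneg zero_le_one fun t ht => mul_nonneg ht.1 ?_
  have hpos := h.pos t ht
  positivity

end ScalarExistence

section EllipticGeodesic

open scoped Matrix.Norms.Operator

variable {d : ℕ} {R : ℝ → Matrix (Fin d) (Fin d) ℝ} {m : ℝ → E d} {h : E d → ℝ} {I : Set ℝ}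

theorem hasDerivWithinAt_inv_det_mul_comp {M : Matrix (Fin d) (Fin d) ℝ} {w : E d} {t : ℝ}
    (hh : Differentiable ℝ h) (hdet : IsUnit (R t).det) (hR : HasDerivWithinAt R (M * R t) I t)
    (hm : HasDerivWithinAt m (act M (m t) + w) I t) (x : E d) :
    HasDerivWithinAt (fun s => (R s).det⁻¹ * h (act (R s)⁻¹ (x - m s)))
      (-(fderiv ℝ (fun y => (R t).det⁻¹ * h (act (R t)⁻¹ (y - m t))) x (act M x + w) +
        (R t).det⁻¹ * h (act (R t)⁻¹ (x - m t)) * M.trace)) I t := by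
  have hinv := hasDerivWithinAt_matrix_inv hR ((Matrix.isUnit_iff_isUnit_det _).mpr hdet)
  rw [← mul_assoc, Matrix.mul_nonsing_inv_cancel_right _ _ hdet] at hinv
  have hpoint : HasDerivWithinAt (fun s => act (R s)⁻¹ (x - m s))
      (-act (R t)⁻¹ (act M x + w)) I t := by
    refine ((actL.hasFDerivAt.comp_hasDerivWithinAt t hinv).clm_apply
      (hm.const_sub x)).congr_deriv ?_
    change act (-((R t)⁻¹ * M)) (x - m t) + act (R t)⁻¹ (-(act M (m t) + w)) = _
    rw [neg_act, act_neg, act_mul, act_sub, ← neg_add, ← act_add, ← add_assoc,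
      sub_add_cancel]
  have hspace : HasFDerivAt (fun y => h (act (R t)⁻¹ (y - m t)))
      ((fderiv ℝ h (act (R t)⁻¹ (x - m t))).comp (actL (R t)⁻¹)) x :=
    (hh _).hasFDerivAt.comp x ((actL (R t)⁻¹).hasFDerivAt.comp x ((hasFDerivAt_id x).sub_const _))
  refine (((hasDerivWithinAt_det hR).inv hdet.ne_zero).mul
    ((hh _).hasFDerivAt.comp_hasDerivWithinAt t hpoint)).congr_deriv ?_
  rw [(hspace.const_mul _).fderiv]
  simp only [Function.comp_apply, Pi.inv_apply, map_neg, smul_apply,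
    ContinuousLinearMap.comp_apply, actL_apply, smul_eq_mul]
  field_simp [hdet.ne_zero]
  ring

theorem contDiffOn_inv_det_mul_comp (hh : ContDiff ℝ ∞ h) (hR : ContDiffOn ℝ ∞ R I)
    (hdet : ∀ t ∈ I, IsUnit (R t).det) (hm : ContDiffOn ℝ ∞ m I) :
    ContDiffOn ℝ ∞ (fun p : ℝ × E d => (R p.1).det⁻¹ * h (act (R p.1)⁻¹ (p.2 - m p.1)))
      (I ×ˢ univ) := by
  have hfst : MapsTo Prod.fst (I ×ˢ (univ : Set (E d))) I := fun p hp => hp.1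
  have hR' := hR.comp contDiffOn_fst hfst
  have hinv : ContDiffOn ℝ ∞ (fun p : ℝ × E d => (R p.1)⁻¹) (I ×ˢ univ) := fun p hp => by
    have hunit := (Matrix.isUnit_iff_isUnit_det _).mpr (hdet p.1 hp.1)
    simp only [Matrix.nonsing_inv_eq_ringInverse]
    exact (contDiffAt_ringInverse ℝ hunit.unit).comp_contDiffWithinAt p (hR' p hp)
  exact ((contDiff_det.comp_contDiffOn hR').inv fun p hp => (hdet p.1 hp.1).ne_zero).mul
    (hh.comp_contDiffOn ((actL.contDiff.comp_contDiffOn hinv).clm_apply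
      (contDiffOn_snd.sub (hm.comp contDiffOn_fst hfst))))

theorem isDualGeodesic_ellipticDensity {g : ℝ → ℝ} {lam : ℝ} {B : Matrix (Fin d) (Fin d) ℝ}
    {b : E d} (hg : IsGenerator d g) (hB : B.IsSymm) (c : ℝ)
    (hR : ContDiffOn ℝ ∞ R (Icc 0 1)) (hm : ContDiffOn ℝ ∞ m (Icc 0 1))
    (hpos : ∀ t ∈ Icc (0 : ℝ) 1, (R t).PosDef)
    (hR' : ∀ t ∈ Icc (0 : ℝ) 1,
      HasDerivWithinAt R (velMat lam (kappa d g • (R t * R t)) B * R t) (Icc 0 1) t)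
    (hm' : ∀ t ∈ Icc (0 : ℝ) 1, HasDerivWithinAt m
      (act (velMat lam (kappa d g • (R t * R t)) B) (m t) +
        velVec lam (kappa d g • (R t * R t)) b) (Icc 0 1) t) :
    IsDualGeodesic lam (fun x => 1 / 2 * quadForm B x + inner ℝ b x + c)
      (fun t => ellipticDensity (m t) (R t * R t) g) := by
  have hsq : ∀ t ∈ Icc (0 : ℝ) 1, (R t * R t).PosDef := fun t ht =>
    posDef_mul_self (hpos t ht)
  have hdens := fun t ht => isSmoothPosDensity_ellipticDensity hg (hsq t ht) (m t)
  have hcov : ∀ t ∈ Icc (0 : ℝ) 1,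
      cov (ellipticDensity (m t) (R t * R t) g) = kappa d g • (R t * R t) := fun t ht =>
    (hasMoments_ellipticDensity hg (hsq t ht) (m t)).cov_eq
  have hformula : ∀ t ∈ Icc (0 : ℝ) 1, ∀ x, ellipticDensity (m t) (R t * R t) g x =
      (R t).det⁻¹ * g (‖act (R t)⁻¹ (x - m t)‖ ^ 2) := fun t ht =>
    ellipticDensity_mul_self (hpos t ht) (m t)
  have hunit := fun t ht => (hpos t ht).det_pos.ne'.isUnit
  have hsmooth := hg.isSmoothPosDensity_isotropic.smooth
  refine ⟨contDiff_quadratic B b c, hdens, ?_, ?_, fun t ht x => ?_⟩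
  · exact (contDiffOn_inv_det_mul_comp hsmooth hR hunit hm).congr fun p hp => hformula p.1 hp.1 p.2
  · exact ((hR.continuousOn.mul hR.continuousOn).const_smul (kappa d g)).congr hcov
  · refine ((hasDerivWithinAt_inv_det_mul_comp (hsmooth.differentiable (by simp)) (hunit t ht)
      (hR' t ht) (hm' t ht) x).congr (fun s hs => hformula s hs x) (hformula t ht x)).congr_deriv ?_
    rw [inertia_quadratic hB (fun _ => rfl) ((hdens t ht).smooth.differentiable (by simp) x),
      hcov t ht, funext (hformula t ht)]

end EllipticGeodesic

section Existence

open scoped Matrix.Norms.Operator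

theorem hasDerivWithinAt_odiag {n : Type*} [Fintype n] [DecidableEq n]
    (U : Matrix.unitaryGroup n ℝ) {v : ℝ → n → ℝ} {v' : n → ℝ} {I : Set ℝ} {t : ℝ}
    (hv : ∀ i, HasDerivWithinAt (fun s => v s i) (v' i) I t) :
    HasDerivWithinAt (fun s => odiag U (v s)) (odiag U v') I t :=
  (LinearMap.toContinuousLinearMap (odiag U).toLinearMap).hasFDerivAt.comp_hasDerivWithinAt t
    (hasDerivWithinAt_pi.mpr hv)

variable {d : ℕ} (U : Matrix.unitaryGroup (Fin d) ℝ) {g : ℝ → ℝ} {lam : ℝ} {β b : Fin d → ℝ}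
  {c n : Fin d → ℝ → ℝ}

theorem act_odiag_act (a x : Fin d → ℝ) :
    act (odiag U a) (act U (WithLp.toLp 2 x)) = act U (WithLp.toLp 2 (a * x)) := by
  rw [odiag_apply, act_mul, act_mul, ← act_mul U.1ᵀ, transpose_mul_coe, act_one]
  congr 1
  ext i
  exact Matrix.mulVec_diagonal a x i

theorem smul_odiag_sqrt_mul_self {κ : ℝ} (hκ : 0 < κ) {v : Fin d → ℝ} (hv : ∀ i, 0 < v i) :
    κ • (odiag U (fun i => √(κ⁻¹ * v i)) * odiag U fun i => √(κ⁻¹ * v i)) = odiag U v := by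
  rw [← map_mul, ← map_smul]
  congr 1
  ext i
  simp only [Pi.smul_apply, Pi.mul_apply, smul_eq_mul]
  rw [Real.mul_self_sqrt (mul_pos (inv_pos.mpr hκ) (hv i)).le, mul_inv_cancel_left₀ hκ.ne']

theorem isDualGeodesic_of_isScalarGeodesic (hg : IsGenerator d g)
    (h : ∀ i, IsScalarGeodesic lam (β i) (b i) (c i) (n i))
    (hc : ∀ i, ContDiffOn ℝ ∞ (c i) (Icc 0 1)) (hn : ∀ i, ContDiffOn ℝ ∞ (n i) (Icc 0 1)) :
    IsDualGeodesic lam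
      (fun x => 1 / 2 * quadForm (odiag U β) x + inner ℝ (act U (WithLp.toLp 2 b)) x + 0)
      (fun t => ellipticDensity (act U (WithLp.toLp 2 fun i => n i t))
        (odiag U (fun i => √((kappa d g)⁻¹ * c i t)) * odiag U fun i => √((kappa d g)⁻¹ * c i t))
        g) := by
  set R : ℝ → Matrix (Fin d) (Fin d) ℝ := fun t => odiag U fun i => √((kappa d g)⁻¹ * c i t)
  have hκ := hg.kappa_pos
  have hpos : ∀ t ∈ Icc (0 : ℝ) 1, ∀ i, 0 < (kappa d g)⁻¹ * c i t := fun t ht i =>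
    mul_pos (inv_pos.mpr hκ) ((h i).pos t ht)
  have hsq : ∀ t ∈ Icc (0 : ℝ) 1, kappa d g • (R t * R t) = odiag U fun i => c i t := fun t ht =>
    smul_odiag_sqrt_mul_self U hκ fun i => (h i).pos t ht
  refine isDualGeodesic_ellipticDensity hg (odiag_transpose U β) 0 ?_ ?_
    (fun t ht => (odiag_posDef_iff U).mpr fun i => Real.sqrt_pos.mpr (hpos t ht i))
    (fun t ht => ?_) (fun t ht => ?_)
  · exact (LinearMap.toContinuousLinearMap (odiag U).toLinearMap).contDiff.comp_contDiffOn
      (contDiffOn_pi.mpr fun i => (contDiffOn_const.mul (hc i)).sqrt fun t ht => (hpos t ht i).ne')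
  · exact (actL U.1).contDiff.comp_contDiffOn
      ((PiLp.continuousLinearEquiv 2 ℝ fun _ : Fin d => ℝ).symm.contDiff.comp_contDiffOn
        (contDiffOn_pi.mpr hn))
  · rw [hsq t ht, velMat_odiag, ← map_mul]
    refine hasDerivWithinAt_odiag U fun i => ?_
    simp only [Real.sqrt_mul (inv_nonneg.mpr hκ.le)]
    refine (((h i).hasDerivWithinAt_sqrt ht).const_mul _).congr_deriv ?_
    simp only [Pi.mul_apply, Pi.add_apply, Pi.smul_apply, Pi.one_apply, smul_eq_mul]
    ring
  · have hcoord : HasDerivWithinAt (fun s i => n i s) _ (Icc 0 1) t :=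
      hasDerivWithinAt_pi.mpr fun i => (h i).mean t ht
    refine (((actL U.1).comp (PiLp.continuousLinearEquiv 2 ℝ fun _ : Fin d =>
      ℝ).symm.toContinuousLinearMap).hasFDerivAt.comp_hasDerivWithinAt t hcoord).congr_deriv ?_
    rw [hsq t ht, velMat_odiag, velVec, odiag_add_smul_one, act_odiag_act, act_odiag_act, ← act_add]
    change act U.1 (WithLp.toLp 2 fun i => (c i t + lam) * (β i * n i t + b i)) = _
    refine congrArg (act U.1) (PiLp.ext fun i => ?_)
    simp only [PiLp.add_apply, Pi.add_apply, Pi.mul_apply, Pi.smul_apply, Pi.one_apply,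
      smul_eq_mul]
    ring

theorem exists_isDualGeodesic (hg : IsGenerator d g) (hlam : 0 < lam) {v w : Fin d → ℝ}
    (hv : ∀ i, 0 < v i) (hw : ∀ i, 0 < w i) (m₀ m₁ : E d) :
    ∃ f ρ, IsQuadratic f ∧ IsDualGeodesic lam f ρ ∧
      ρ 0 = ellipticDensity m₀ (odiag U v) g ∧ ρ 1 = ellipticDensity m₁ (odiag U w) g := by
  have hκ := hg.kappa_pos
  choose β b c n hs hc hn hc₀ hc₁ hn₀ hn₁ using fun i =>
    exists_isScalarGeodesic hlam (mul_pos hκ (hv i)) (mul_pos hκ (hw i)) (act U.1ᵀ m₀ i)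
      (act U.1ᵀ m₁ i)
  have hmean : ∀ m : E d, act U (WithLp.toLp 2 fun i => act U.1ᵀ m i) = m := fun m => by
    change act U (act U.1ᵀ m) = m
    rw [← act_mul, coe_mul_transpose, act_one]
  have hcov : ∀ {u : Fin d → ℝ}, (∀ i, 0 < u i) →
      odiag U (fun i => √((kappa d g)⁻¹ * (kappa d g * u i))) *
        odiag U (fun i => √((kappa d g)⁻¹ * (kappa d g * u i))) = odiag U u := fun {u} hu => by
    simp only [inv_mul_cancel_left₀ hκ.ne', ← map_mul]
    exact congrArg _ (funext fun i => Real.mul_self_sqrt (hu i).le)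
  refine ⟨_, _, ⟨_, _, _, odiag_transpose U β, fun _ => rfl⟩,
    isDualGeodesic_of_isScalarGeodesic U hg hs hc hn, ?_, ?_⟩
  · simp only [hc₀, hn₀, hcov hv, hmean]
  · simp only [hc₁, hn₁, hcov hw, hmean]

end Existence

/-! ### The divergence of elliptic distributions -/

section Divergence

variable {d : ℕ} {g : ℝ → ℝ} {lam : ℝ} {S : Matrix (Fin d) (Fin d) ℝ} {m : E d} {ρ : E d → ℝ}

theorem IsSmoothPosDensity.hasMoments_of_ofDensity_eq (hρ : IsSmoothPosDensity ρ)
    (hg : IsGenerator d g) (hS : S.PosDef)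
    (h : ofDensity ρ = ofDensity (ellipticDensity m S g)) : HasMoments ρ m (kappa d g • S) :=
  (hasMoments_ellipticDensity hg hS m).congr_ae
    (ae_eq_of_ofDensity_eq hρ (isSmoothPosDensity_ellipticDensity hg hS m) h).symm

theorem divKW_ellipticDensity (U : Matrix.unitaryGroup (Fin d) ℝ) (hg : IsGenerator d g)
    (hlam : 0 < lam) {v w : Fin d → ℝ} (hv : ∀ i, 0 < v i) (hw : ∀ i, 0 < w i) (m₀ m₁ : E d) :
    divKW lam (ofDensity (ellipticDensity m₀ (odiag U v) g))
        (ofDensity (ellipticDensity m₁ (odiag U w) g)) =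
      ENNReal.ofReal
        (∑ i, coordValue lam (kappa d g * v i) (kappa d g * w i) (act U.1ᵀ (m₁ - m₀) i)) := by
  have hV := (odiag_posDef_iff U).mpr hv
  have hW := (odiag_posDef_iff U).mpr hw
  have haction : ∀ {f : E d → ℝ} {ρ : ℝ → E d → ℝ}, IsQuadratic f → IsDualGeodesic lam f ρ →
      ofDensity (ρ 0) = ofDensity (ellipticDensity m₀ (odiag U v) g) →
      ofDensity (ρ 1) = ofDensity (ellipticDensity m₁ (odiag U w) g) →
      action lam f ρ = ENNReal.ofReal
        (∑ i, coordValue lam (kappa d g * v i) (kappa d g * w i) (act U.1ᵀ (m₁ - m₀) i)) := by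
    intro f ρ hf h h₀ h₁
    have hM₀ := (h.density 0 (by simp)).hasMoments_of_ofDensity_eq hg hV h₀
    have hM₁ := (h.density 1 (by simp)).hasMoments_of_ofDensity_eq hg hW h₁
    rw [← map_smul] at hM₀ hM₁
    exact h.action_eq U hf hlam (fun i => mul_pos hg.kappa_pos (hv i)) hM₀ hM₁
  obtain ⟨f, ρ, hf, h, h₀, h₁⟩ := exists_isDualGeodesic U hg hlam hv hw m₀ m₁
  have h₀' := congrArg ofDensity h₀
  have h₁' := congrArg ofDensity h₁
  refine le_antisymm ?_ ?_
  · rw [← haction hf h h₀' h₁']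
    exact iInf_le_of_le f <| iInf_le_of_le ρ <| iInf_le_of_le hf <| iInf_le_of_le h <|
      iInf_le_of_le h₀' <| iInf_le _ h₁'
  · exact le_iInf fun _ => le_iInf fun _ => le_iInf fun hf => le_iInf fun h => le_iInf fun h₀ =>
      le_iInf fun h₁ => (haction hf h h₀ h₁).ge

end Divergence

end KW

end

theorem mainTheorem1 {d : ℕ} (m₀ m₁ : KW.E d) (S₀ S₁ : Matrix (Fin d) (Fin d) ℝ) (g : ℝ → ℝ)
    (μ ν : Measure (KW.E d))
    (hμ : KW.IsElliptic m₀ S₀ g μ) (hν : KW.IsElliptic m₁ S₁ g ν)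
    (hdiag : KW.SimDiag S₀ S₁) (lam : ℝ) (hlam : 0 < lam) :
    ((KW.divKW lam μ ν : ℝ≥0∞) : EReal) =
      ((KW.kappa d g / (4 * lam) * (KW.Xi (KW.kappa d g) lam S₀ S₁).trace +
        1 / 2 * KW.quadForm
          (KW.projPerp S₀ S₁ * (KW.inflate (KW.kappa d g) lam S₀)⁻¹ * KW.projPerp S₀ S₁ +
            (1 / (2 * lam)) • (KW.proj S₀ S₁ * KW.Xi (KW.kappa d g) lam S₀ S₁ * KW.proj S₀ S₁ *
              KW.pinv (KW.msqrt S₁ - KW.msqrt S₀) ^ 2))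
          (m₁ - m₀) : ℝ) : EReal) := by
  obtain ⟨U, v, w, rfl, rfl⟩ := hdiag.exists_odiag hμ.posDef.isHermitian hν.posDef.isHermitian
  have hv := (KW.odiag_posDef_iff U).mp hμ.posDef
  have hw := (KW.odiag_posDef_iff U).mp hν.posDef
  have hκ := hμ.generator.kappa_pos
  have hnonneg : 0 ≤ ∑ i, KW.coordValue lam (KW.kappa d g * v i) (KW.kappa d g * w i)
      (KW.act U.1ᵀ (m₁ - m₀) i) := Finset.sum_nonneg fun i _ =>
    KW.coordValue_nonneg hlam (mul_pos hκ (hv i)) (mul_pos hκ (hw i)) _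
  rw [hμ.density, hν.density, KW.divKW_ellipticDensity U hμ.generator hlam hv hw,
    KW.closedForm_eq_sum U hv hw hκ hlam, EReal.coe_ennreal_ofReal, max_eq_left hnonneg]
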